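/- For $m\ge 1$ let $\mathbb S_m$ be the group of permutations of $[m]$. A ranking of $m$ alternatives is a permutation $x\in\mathbb S_m$, read as $x(\text{rank})=\text{name}$. A subgroup $H\subseteq \mathbb S_m$ is called *fixing* if there is a partition of the $m$ ranks into at least $2$ nonempty parts such that $H$ consists of all permutations mapping each part onto itself. Products of permutations are read from left to right, so that the right coset $Hy$ is the set of rankings $r\mapsto y(h(r))$, $h\in H$; $\mathbb S_m/H$ denotes the set of these cosets. An $H$-social aggregator is a function $f:\mathbb S_m^n\to\mathbb S_m/H$. For a coset $K$ and $j\in[m]$ the $j$-profile of $K$ is the multiset $K^{-1}(j)=\{y^{-1}(j) : y\in K\}$, and $\mathbf n_{S}\in\mathbb R^m$ denotes the vector of multiplicities of a multiset $S$. Put $$IR(f)=\sum_{i\in[n]}\sum_{j\in[m]}\mathbb E_{x^{-i},x_i,y_i}\left(\mathbf 1_{x_i^{-1}(j)=y_i^{-1}(j)}\left\|\frac{\mathbf n_{f(x^{-i},x_i)^{-1}(j)}-\mathbf n_{f(x^{-i},y_i)^{-1}(j)}}{|H|}\right\|_2^2\right),$$ where $x^{-i}\in\mathbb S_m^{n-1}$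 and $x_i,y_i\in\mathbb S_m$ are independent and uniform. The aggregator $f$ is called $\epsilon$-IR if $IR(f)\le\epsilon$. **Theorem.** There are absolute constants $C>0$ and $k\in\mathbb N$ such that the following holds for all $m\ge 3$, all fixing subgroups $H$ of $\mathbb S_m$, all $n$, all real $\epsilon$ and all $H$-social aggregators $f:\mathbb S_m^n\to\mathbb S_m/H$. If $f$ is $\epsilon$-IR, then there is a function $g:\mathbb S_m^n\to\mathbb S_m/H$ with $$\Pr_{x\in\mathbb S_m^n}\left[f(x)\ne g(x)\right]\le C\,m^k\,\epsilon$$ (for uniform $x$) such that either $g$ is constant or $g$ is dictatorial in the following sense: there are a voter $i\in[n]$ and a permutation $y\in\mathbb S_m$ of the ranks such that $g(x)$, for every $x$, is the coset of $H$ that contains the ranking $r\mapsto x_i(y(r))$ (that is, $g(x)=H\,y\,x_i$ with products read from left to right). -/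

import Mathlib

open scoped BigOperators

namespace SocialIR

/-- A ranking of `m` alternatives: the bijection sending each rank to the name of the alternative
placed there. -/
abbrev Ranking (m : ℕ) : Type := Equiv.Perm (Fin m)

/-- A voting profile of `n` voters. -/
abbrev Profile (n m : ℕ) : Type := Fin n → Ranking m

/-- `H` is a fixing subgroup: it consists of all permutations of the ranks that map each part of
some partition of the ranks into at least two (nonempty) parts onto itself. -/
def IsFixing {m : ℕ} (H : Subgroup (Ranking m)) : Prop :=
  ∃ P : Finpartition (Finset.univ : Finset (Fin m)), 2 ≤ P.parts.card ∧
    ∀ σ : Ranking m, σ ∈ H ↔ ∀ A ∈ P.parts, A.image σ = A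

/-- Cosets of `H`, as the set of partial rankings. A member of `H` permutes the ranks before the
ranking `y` is applied, so the coset of `y` is the set of the rankings
`rank ↦ y (h rank)` with `h ∈ H`; multiplying permutations from left to right (as one does when
`y` is regarded as a map from ranks to names and `h` acts first) this is the right coset `H y`.
Mathlib's product of permutations is `(y * h) r = y (h r)`, so in Mathlib it is the coset
`{y * h | h ∈ H}`, that is, an element of `Equiv.Perm (Fin m) ⧸ H`. -/
abbrev PartialRanking {m : ℕ} (H : Subgroup (Ranking m)) : Type := Ranking m ⧸ H

/-- An `H`-social aggregator on `n` voters. -/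
abbrev Aggregator (n : ℕ) {m : ℕ} (H : Subgroup (Ranking m)) : Type :=
  Profile n m → PartialRanking H

open Classical in
/-- The set of rankings that make up a coset. -/
noncomputable def members {m : ℕ} {H : Subgroup (Ranking m)} (K : PartialRanking H) :
    Finset (Ranking m) :=
  Finset.univ.filter fun y => (QuotientGroup.mk y : PartialRanking H) = K

/-- The `j`-profile of a coset `K`: the multiset of the `y⁻¹ j`, for `y ∈ K`. -/
noncomputable def jProfile {m : ℕ} {H : Subgroup (Ranking m)} (K : PartialRanking H)
    (j : Fin m) : Multiset (Fin m) :=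
  (members K).val.map fun y => y⁻¹ j

/-- The squared Euclidean norm of the difference of the characteristic vectors of the `j`-profiles
of `K` and `K'`, divided by `|H|`. -/
noncomputable def jDistSq {m : ℕ} {H : Subgroup (Ranking m)} (K K' : PartialRanking H)
    (j : Fin m) : ℝ :=
  ∑ r : Fin m,
    ((((jProfile K j).count r : ℝ) - ((jProfile K' j).count r : ℝ)) / (Nat.card H : ℝ)) ^ 2

/-- `IR(f)`: the sum over voters `i` and alternatives `j` of the expectation, over a uniform
profile `x` and an independent uniform new vote `z` of voter `i`, of the squared distance of the
`j`-profiles of the two outcomes, counted only if both votes rank `j` equally. -/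
noncomputable def IR {n m : ℕ} {H : Subgroup (Ranking m)} (f : Aggregator n H) : ℝ :=
  ∑ i : Fin n, ∑ j : Fin m, 𝔼 x : Profile n m, 𝔼 z : Ranking m,
    if (x i)⁻¹ j = z⁻¹ j then jDistSq (f x) (f (Function.update x i z)) j else 0

/-- `f` is `ε`-IR. -/
def IsEpsIR {n m : ℕ} {H : Subgroup (Ranking m)} (f : Aggregator n H) (ε : ℝ) : Prop :=
  IR f ≤ ε

/-- `f` is constant. -/
def IsConstant {n m : ℕ} {H : Subgroup (Ranking m)} (f : Aggregator n H) : Prop :=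
  ∃ K : PartialRanking H, ∀ x, f x = K

/-- `f` is dictatorial: for some voter `i` and some permutation `y` of the ranks, `f x` is the
coset of the ranking `rank ↦ x i (y rank)`. -/
def IsDictatorial {n m : ℕ} {H : Subgroup (Ranking m)} (f : Aggregator n H) : Prop :=
  ∃ (i : Fin n) (y : Ranking m), ∀ x, f x = QuotientGroup.mk (x i * y)

open Classical in
/-- The probability that `f` and `g` differ at a uniformly random profile. -/
noncomputable def dist {n m : ℕ} {H : Subgroup (Ranking m)} (f g : Aggregator n H) : ℝ :=
  𝔼 x : Profile n m, if f x ≠ g x then (1 : ℝ) else 0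

end SocialIR

set_option linter.unusedSectionVars false

namespace SocialIR

/-! ### Uniform averages over permutations and products -/

/-! Describe an outcome by its labels: the part of the ranks in which it places each alternative
`j`. Labels determine the outcome, and their histogram, given by the part sizes, never varies. Small
`IR` means that the label of `j` rarely changes when a voter changes a vote but keeps the rank of
`j`. Resampling all votes in turn, the label of `j` is close to a function `G j` of the ranks of `j`
alone (`exists_near_function_of_ranks`).

Hence the one-hot vectors of the `G j` almost sum to a constant. Expand them in a product basis. A
basis function involving `w` voters, evaluated at the ranks of two different alternatives, has
correlation `(-1/(m-1))^w`; different basis functions are uncorrelated. For `w ≥ 2` and `m ≥ 3` this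
is too weak for the alternatives to cancel each other, so these coefficients are small. For `w = 1`
cancellation is possible, but only if the coefficients are nearly the same for all alternatives
(`coeff_bounds_of_sum_near_const`).

So each `G j` is almost a sum of contributions of single voters, with almost the same first-order
part for all `j`. A one-hot function of this kind cannot have two independent groups of voters that
both matter, so one voter `i` carries the variance (`exists_dominant_coord`), and `i` serves all
alternatives: `G j` is close to `c j + h r`, with `r` the rank that `i` gives to `j`
(`exists_common_voter`). After rounding to labels `ψ j r`, additivity and discreteness leave only
functions of `j` (a constant aggregator) or of `r` (a dictator), by `eq_const_or_eq_common`. All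
losses are polynomial in `m`. -/

lemma expect_inv_apply {α : Type*} [Fintype α] [DecidableEq α] (j : α) (φ : α → ℝ) :
    𝔼 x : Equiv.Perm α, φ (x⁻¹ j) = 𝔼 r, φ r := by
  have key : ∀ k, 𝔼 x : Equiv.Perm α, φ (x⁻¹ k) = 𝔼 x : Equiv.Perm α, φ (x⁻¹ j) := by
    intro k
    refine Fintype.expect_equiv (Equiv.mulLeft (Equiv.swap j k)) _ _ fun x => ?_
    simp [mul_inv_rev]
  have : Nonempty α := ⟨j⟩
  calc 𝔼 x : Equiv.Perm α, φ (x⁻¹ j) = 𝔼 k, 𝔼 x : Equiv.Perm α, φ (x⁻¹ k) := by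
        simp_rw [key]; rw [Fintype.expect_const]
    _ = 𝔼 x : Equiv.Perm α, 𝔼 k, φ (x⁻¹ k) := Finset.expect_comm ..
    _ = 𝔼 _x : Equiv.Perm α, 𝔼 r, φ r := by
        refine Finset.expect_congr rfl fun x _ => ?_
        exact Fintype.expect_equiv x⁻¹ _ _ fun _ => rfl
    _ = 𝔼 r, φ r := Fintype.expect_const _

/-- All names other than `j` are exchangeable, and the values of `b` over them sum to `-b (x⁻¹ j)`.
This is the negative correlation of the ranks of two alternatives. -/
lemma expect_inv_apply_mul_inv_apply {α : Type*} [Fintype α] [DecidableEq α] {j k : α}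
    (hjk : j ≠ k) (a b : α → ℝ) (hb : ∑ r, b r = 0) :
    ((Fintype.card α : ℝ) - 1) * 𝔼 x : Equiv.Perm α, a (x⁻¹ j) * b (x⁻¹ k) =
      -𝔼 r, a r * b r := by
  have key : ∀ l ∈ Finset.univ.erase j, 𝔼 x : Equiv.Perm α, a (x⁻¹ j) * b (x⁻¹ l) =
      𝔼 x : Equiv.Perm α, a (x⁻¹ j) * b (x⁻¹ k) := by
    intro l hl
    refine Fintype.expect_equiv (Equiv.mulLeft (Equiv.swap k l)) _ _ fun x => ?_
    have : Equiv.swap k l j = j :=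
      Equiv.swap_apply_of_ne_of_ne hjk (Finset.ne_of_mem_erase hl).symm
    simp [mul_inv_rev, this]
  have hsum := Finset.sum_congr rfl key
  have hc : ((Finset.univ.erase j).card : ℝ) = (Fintype.card α : ℝ) - 1 := by
    rw [Finset.card_erase_of_mem (Finset.mem_univ j), Finset.card_univ, Nat.cast_sub, Nat.cast_one]
    exact Fintype.card_pos_iff.2 ⟨j⟩
  rw [Finset.sum_const, nsmul_eq_mul, hc, ← Finset.expect_sum_comm] at hsum
  rw [← hsum, ← expect_inv_apply j fun r => a r * b r, ← Finset.expect_neg_distrib]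
  refine Finset.expect_congr rfl fun x _ => ?_
  rw [← Finset.mul_sum]
  have h0 : ∑ l, b (x⁻¹ l) = 0 := by rw [Equiv.sum_comp x⁻¹ b, hb]
  rw [← Finset.add_sum_erase _ _ (Finset.mem_univ j)] at h0
  rw [eq_neg_of_add_eq_zero_right h0, mul_neg]

lemma expect_pi_prod {ι Ω : Type*} [Fintype ι] [DecidableEq ι] [Fintype Ω]
    (φ : ι → Ω → ℝ) : 𝔼 x : ι → Ω, ∏ i, φ i (x i) = ∏ i, 𝔼 z, φ i z := by
  simp_rw [Fintype.expect_eq_sum_div_card]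
  rw [Finset.prod_div_distrib, Finset.prod_univ_sum]
  simp

lemma expect_update {ι Ω : Type*} [Fintype ι] [DecidableEq ι] [Fintype Ω] [Nonempty Ω]
    (i : ι) (Φ : (ι → Ω) → ℝ) :
    𝔼 x : ι → Ω, 𝔼 z, Φ (Function.update x i z) = 𝔼 x, Φ x := by
  have h1 : 𝔼 p : (ι → Ω) × Ω, Φ (Function.update p.1 i p.2) = 𝔼 p : (ι → Ω) × Ω, Φ p.1 := by
    let e : (ι → Ω) × Ω → (ι → Ω) × Ω := fun p => (Function.update p.1 i p.2, p.1 i)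
    have he : Function.Involutive e := fun p => by simp [e]
    exact Fintype.expect_equiv he.toPerm _ _ fun _ => rfl
  rw [← Finset.univ_product_univ, Finset.expect_product, Finset.expect_product] at h1
  rw [h1]
  exact Finset.expect_congr rfl fun x _ => Fintype.expect_const (Φ x)

lemma expect_coord {ι Ω : Type*} [Fintype ι] [DecidableEq ι] [Fintype Ω] [Nonempty Ω]
    (i : ι) (φ : Ω → ℝ) : 𝔼 x : ι → Ω, φ (x i) = 𝔼 z, φ z := by
  rw [← expect_update i fun x => φ (x i)]
  simp

lemma expect_coord_inv_apply {ι α : Type*} [Fintype ι] [DecidableEq ι] [Fintype α] [DecidableEq α]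
    (i : ι) (j : α) (φ : α → ℝ) :
    𝔼 x : ι → Equiv.Perm α, φ ((x i)⁻¹ j) = 𝔼 r, φ r := by
  rw [expect_coord i fun y : Equiv.Perm α => φ (y⁻¹ j), expect_inv_apply]

/-! ### One-hot vectors -/

section OneHot
variable {L : Type*} [Fintype L] [DecidableEq L]

/-- The unit vector with entry `1` at `a`. -/
noncomputable def oneHot (a : L) : EuclideanSpace ℝ L := EuclideanSpace.single a 1

lemma norm_oneHot_sub_sq (a b : L) :
    ‖oneHot a - oneHot b‖ ^ 2 = 2 * if a ≠ b then (1 : ℝ) else 0 := by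
  by_cases h : a = b
  · simp [h]
  · rw [norm_sub_sq_real]
    simp [oneHot, h, EuclideanSpace.inner_single_left]
    norm_num

lemma one_le_norm_oneHot_sub {a b : L} (h : a ≠ b) : 1 ≤ ‖oneHot a - oneHot b‖ := by
  have := norm_oneHot_sub_sq a b
  rw [if_pos h] at this
  nlinarith [norm_nonneg (oneHot a - oneHot b)]

lemma norm_oneHot_sub_le (a b : L) : ‖oneHot a - oneHot b‖ ≤ 2 :=
  (norm_sub_le _ _).trans (by simp [oneHot]; norm_num)

/-- An alternating sum of four unit vectors that is shorter than `1` cancels in pairs. -/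
lemma oneHot_rect {a b c d : L} (h : ‖oneHot a - oneHot b - oneHot c + oneHot d‖ < 1) :
    (a = b ∧ c = d) ∨ (a = c ∧ b = d) := by
  by_cases hab : a = b
  · left
    refine ⟨hab, ?_⟩
    by_contra hcd
    have := one_le_norm_oneHot_sub (Ne.symm hcd)
    rw [hab, sub_self, zero_sub, neg_add_eq_sub] at h
    linarith
  by_cases hac : a = c
  · right
    refine ⟨hac, ?_⟩
    by_contra hbd
    have := one_le_norm_oneHot_sub (Ne.symm hbd)
    rw [hac, show oneHot c - oneHot b - oneHot c + oneHot d = oneHot d - oneHot b by abel] at h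
    linarith
  -- The coordinate at `a` is `1 - 0 - 0` plus `0` or `1`, so it is at least `1`.
  exfalso
  have h1 := (PiLp.norm_apply_le (oneHot a - oneHot b - oneHot c + oneHot d) a).trans_lt h
  simp only [oneHot, PiLp.add_apply, PiLp.sub_apply, PiLp.single_apply, hab, hac,
    if_true, if_false, Real.norm_eq_abs] at h1
  split_ifs at h1 <;> norm_num at h1

end OneHot

/-! ### A Friedgut–Kalai–Naor theorem for one-hot functions on product spaces -/

/-- Truncation at `K / 2` loses at most half of the mean, because `s - s² / (2K) ≤ min s (K / 2)`:
the two gaps are `s² / (2K)` and `(s - K)² / (2K)`. -/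
lemma half_le_expect_min {γ : Type*} [Fintype γ] [Nonempty γ] {W : γ → ℝ} {w K : ℝ}
    (hK : 0 < K) (hw0 : 0 < w) (hWw : 𝔼 c, W c = w) (hW2 : 𝔼 c, W c ^ 2 ≤ K * w ^ 2) :
    1 / 2 ≤ 𝔼 c, min (W c / w) (K / 2) := by
  have trunc : ∀ s : ℝ, s - s ^ 2 / (2 * K) ≤ min s (K / 2) := by
    intro s
    refine le_min (sub_le_self _ (by positivity)) ?_
    rw [sub_le_iff_le_add, ← sub_nonneg]
    have : K / 2 + s ^ 2 / (2 * K) - s = (s - K) ^ 2 / (2 * K) := by field_simp; ring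
    rw [this]; positivity
  calc (1 : ℝ) / 2 ≤ 1 - (K * w ^ 2) / (2 * K * w ^ 2) := by
        rw [mul_assoc 2 K, mul_comm 2, ← div_div, div_self (by positivity)]; norm_num
    _ ≤ 1 - (𝔼 c, W c ^ 2) / (2 * K * w ^ 2) := by gcongr
    _ = 𝔼 c, (W c / w - (W c / w) ^ 2 / (2 * K)) := by
        rw [Finset.expect_sub_distrib, ← Finset.expect_div, hWw, div_self hw0.ne']
        congr 1
        rw [Finset.expect_div]
        refine Finset.expect_congr rfl fun c _ => ?_
        field_simp
    _ ≤ _ := Finset.expect_le_expect fun c _ => trunc _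

/-- Independent nonnegative variables whose second moments are controlled by their means:
the mean of the minimum is comparable to the minimum of the means. -/
lemma min_expect_le {α β : Type*} [Fintype α] [Fintype β] [Nonempty α] [Nonempty β]
    {U : α → ℝ} {V : β → ℝ} {K : ℝ} (hK : 0 < K) (hU : ∀ a, 0 ≤ U a) (hV : ∀ b, 0 ≤ V b)
    (hU2 : 𝔼 a, U a ^ 2 ≤ K * (𝔼 a, U a) ^ 2) (hV2 : 𝔼 b, V b ^ 2 ≤ K * (𝔼 b, V b) ^ 2) :
    min (𝔼 a, U a) (𝔼 b, V b) ≤ 2 * K * 𝔼 a, 𝔼 b, min (U a) (V b) := by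
  set μ := 𝔼 a, U a with hμ
  set ν := 𝔼 b, V b with hν
  have hnn : 0 ≤ 𝔼 a, 𝔼 b, min (U a) (V b) := Finset.expect_nonneg fun a _ =>
    Finset.expect_nonneg fun b _ => le_min (hU a) (hV b)
  by_cases hw : min μ ν ≤ 0
  · exact hw.trans (by positivity)
  push Not at hw
  have hμ0 : 0 < μ := hw.trans_le (min_le_left _ _)
  have hν0 : 0 < ν := hw.trans_le (min_le_right _ _)
  have hA := half_le_expect_min hK hμ0 hμ.symm hU2
  have hB := half_le_expect_min hK hν0 hν.symm hV2
  have hprod : ∀ s t : ℝ, 0 ≤ s → 0 ≤ t → min s (K / 2) * min t (K / 2) ≤ K / 2 * min s t := by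
    intro s t hs ht
    have hs' : 0 ≤ min s (K / 2) := le_min hs (by positivity)
    have ht' : 0 ≤ min t (K / 2) := le_min ht (by positivity)
    rcases le_total s t with h | h
    · rw [min_eq_left h, mul_comm (K / 2)]
      exact mul_le_mul (min_le_left _ _) (min_le_right _ _) ht' hs
    · rw [min_eq_right h]
      exact mul_le_mul (min_le_right _ _) (min_le_left _ _) ht' (by positivity)
  have hmin : ∀ a b, min μ ν * min (U a / μ) (V b / ν) ≤ min (U a) (V b) := by
    intro a b
    have h0 : 0 ≤ min (U a / μ) (V b / ν) :=
      le_min (div_nonneg (hU a) hμ0.le) (div_nonneg (hV b) hν0.le)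
    refine le_min ?_ ?_
    · calc _ ≤ μ * (U a / μ) := mul_le_mul (min_le_left _ _) (min_le_left _ _) h0 hμ0.le
        _ = U a := by field_simp
    · calc _ ≤ ν * (V b / ν) := mul_le_mul (min_le_right _ _) (min_le_right _ _) h0 hν0.le
        _ = V b := by field_simp
  calc min μ ν = min μ ν * (4 * (1 / 2 * (1 / 2))) := by ring
    _ ≤ min μ ν * (4 * ((𝔼 a, min (U a / μ) (K / 2)) * 𝔼 b, min (V b / ν) (K / 2))) := by
        gcongr
    _ = 𝔼 a, 𝔼 b, min μ ν * (4 * (min (U a / μ) (K / 2) * min (V b / ν) (K / 2))) := by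
        rw [Fintype.expect_mul_expect]; simp_rw [Finset.mul_expect]
    _ ≤ 𝔼 a, 𝔼 b, 2 * K * min (U a) (V b) := by
        refine Finset.expect_le_expect fun a _ => Finset.expect_le_expect fun b _ => ?_
        calc _ ≤ min μ ν * (4 * (K / 2 * min (U a / μ) (V b / ν))) := by
              refine mul_le_mul_of_nonneg_left (mul_le_mul_of_nonneg_left
                (hprod _ _ (div_nonneg (hU a) hμ0.le) (div_nonneg (hV b) hν0.le)) ?_) hw.le
              norm_num
          _ = 2 * K * (min μ ν * min (U a / μ) (V b / ν)) := by ring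
          _ ≤ _ := by gcongr; exact hmin a b
    _ = _ := by simp_rw [Finset.mul_expect]

/-! ### Two independent groups of coordinates cannot both have large variance -/

section Block
variable {L : Type*} [Fintype L] [DecidableEq L]

/-- In the alternating sum over the four corners of a rectangle `c`, `X` and `Y` cancel. If the
total error `t` is below `1`, the one-hot vectors must therefore cancel in pairs (`oneHot_rect`),
and one of the two differences consists of errors only. If `t ≥ 1`, the trivial bound `t + 2 ≤ 3 *
t` suffices. The constant is `3² * 4`, the `4` from squaring a sum of four terms. -/
lemma min_norm_sub_sq_le {α β : Type*} (c : EuclideanSpace ℝ L) (X : α → EuclideanSpace ℝ L)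
    (Y : β → EuclideanSpace ℝ L) (F : α → β → L) (a a' : α) (b b' : β) :
    min (‖X a - X a'‖ ^ 2) (‖Y b - Y b'‖ ^ 2) ≤
      36 * (‖c + X a + Y b - oneHot (F a b)‖ ^ 2 + ‖c + X a + Y b' - oneHot (F a b')‖ ^ 2 +
        ‖c + X a' + Y b - oneHot (F a' b)‖ ^ 2 + ‖c + X a' + Y b' - oneHot (F a' b')‖ ^ 2) := by
  set e1 := c + X a + Y b - oneHot (F a b) with h1
  set e2 := c + X a + Y b' - oneHot (F a b') with h2
  set e3 := c + X a' + Y b - oneHot (F a' b) with h3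
  set e4 := c + X a' + Y b' - oneHot (F a' b') with h4
  set t := ‖e1‖ + ‖e2‖ + ‖e3‖ + ‖e4‖ with ht
  have n1 := norm_nonneg e1
  have n2 := norm_nonneg e2
  have n3 := norm_nonneg e3
  have n4 := norm_nonneg e4
  have hX : X a - X a' = (e1 - e3) + (oneHot (F a b) - oneHot (F a' b)) := by
    rw [h1, h3]; abel
  have hY : Y b - Y b' = (e1 - e2) + (oneHot (F a b) - oneHot (F a b')) := by
    rw [h1, h2]; abel
  have hlow : min ‖X a - X a'‖ ‖Y b - Y b'‖ ≤ 3 * t := by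
    by_cases ht1 : t < 1
    · have hr : ‖oneHot (F a b) - oneHot (F a b') - oneHot (F a' b) + oneHot (F a' b')‖ < 1 := by
        refine lt_of_le_of_lt ?_ ht1
        rw [show oneHot (F a b) - oneHot (F a b') - oneHot (F a' b) + oneHot (F a' b') =
          -e1 + e2 + e3 - e4 by rw [h1, h2, h3, h4]; abel]
        calc _ ≤ ‖-e1 + e2 + e3‖ + ‖e4‖ := norm_sub_le _ _
          _ ≤ ‖-e1 + e2‖ + ‖e3‖ + ‖e4‖ := by gcongr; exact norm_add_le _ _
          _ ≤ ‖-e1‖ + ‖e2‖ + ‖e3‖ + ‖e4‖ := by gcongr; exact norm_add_le _ _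
          _ = t := by rw [norm_neg]
      rcases oneHot_rect hr with ⟨h, _⟩ | ⟨h, _⟩
      · refine (min_le_right _ _).trans ?_
        rw [hY, h, sub_self, add_zero]
        linarith [norm_sub_le e1 e2]
      · refine (min_le_left _ _).trans ?_
        rw [hX, h, sub_self, add_zero]
        linarith [norm_sub_le e1 e3]
    · push Not at ht1
      refine (min_le_left _ _).trans ?_
      rw [hX]
      linarith [norm_add_le (e1 - e3) (oneHot (F a b) - oneHot (F a' b)), norm_sub_le e1 e3,
        norm_oneHot_sub_le (F a b) (F a' b)]
  have hsq : min (‖X a - X a'‖ ^ 2) (‖Y b - Y b'‖ ^ 2) ≤ (3 * t) ^ 2 := by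
    rcases min_le_iff.1 hlow with h | h
    · exact (min_le_left _ _).trans (by gcongr)
    · exact (min_le_right _ _).trans (by gcongr)
  refine hsq.trans ?_
  rw [ht]
  nlinarith [sq_nonneg (‖e1‖ - ‖e2‖), sq_nonneg (‖e1‖ - ‖e3‖), sq_nonneg (‖e1‖ - ‖e4‖),
    sq_nonneg (‖e2‖ - ‖e3‖), sq_nonneg (‖e2‖ - ‖e4‖), sq_nonneg (‖e3‖ - ‖e4‖)]

lemma expect_inner_left {E α : Type*} [NormedAddCommGroup E] [InnerProductSpace ℝ E] [Fintype α]
    {X : α → E} (hX : ∑ a, X a = 0) (v : E) : 𝔼 a, inner ℝ (X a) v = 0 := by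
  rw [Fintype.expect_eq_sum_div_card, ← sum_inner, hX, inner_zero_left, zero_div]

lemma expect_norm_sub_sq {E α : Type*} [NormedAddCommGroup E] [InnerProductSpace ℝ E] [Fintype α]
    [Nonempty α] {X : α → E} (hX : ∑ a, X a = 0) :
    𝔼 p : α × α, ‖X p.1 - X p.2‖ ^ 2 = 2 * 𝔼 a, ‖X a‖ ^ 2 := by
  rw [← Finset.univ_product_univ, Finset.expect_product]
  simp_rw [norm_sub_sq_real, Finset.expect_add_distrib, Finset.expect_sub_distrib,
    ← Finset.mul_expect, Fintype.expect_const]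
  rw [Finset.expect_comm]
  simp_rw [expect_inner_left hX]
  simp
  ring

lemma expect_norm_sub_pow_four {E α : Type*} [NormedAddCommGroup E] [InnerProductSpace ℝ E]
    [Fintype α] [Nonempty α] (X : α → E) :
    𝔼 p : α × α, (‖X p.1 - X p.2‖ ^ 2) ^ 2 ≤ 16 * 𝔼 a, ‖X a‖ ^ 4 := by
  rw [← Finset.univ_product_univ, Finset.expect_product]
  calc _ ≤ 𝔼 a, 𝔼 b, (8 * ‖X a‖ ^ 4 + 8 * ‖X b‖ ^ 4) := by
        refine Finset.expect_le_expect fun a _ => Finset.expect_le_expect fun b _ => ?_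
        have h1 : ‖X a - X b‖ ^ 2 ≤ 2 * ‖X a‖ ^ 2 + 2 * ‖X b‖ ^ 2 := by
          have := norm_sub_le (X a) (X b)
          nlinarith [norm_nonneg (X a - X b), sq_nonneg (‖X a‖ - ‖X b‖), norm_nonneg (X a),
            norm_nonneg (X b)]
        calc (‖X a - X b‖ ^ 2) ^ 2 ≤ (2 * ‖X a‖ ^ 2 + 2 * ‖X b‖ ^ 2) ^ 2 := by gcongr
          _ ≤ _ := by nlinarith [sq_nonneg (‖X a‖ ^ 2 - ‖X b‖ ^ 2)]
    _ = _ := by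
        simp_rw [Finset.expect_add_distrib, ← Finset.mul_expect, Fintype.expect_const]
        ring

/-- Differences of independent copies have mean square twice the variance, and their fourth-moment
ratio is at most `16 K / 2² = 4 K`, which is the constant given to `min_expect_le`. -/
lemma min_variance_le {α β : Type*} [Fintype α] [Fintype β] [Nonempty α] [Nonempty β]
    {c : EuclideanSpace ℝ L} {X : α → EuclideanSpace ℝ L} {Y : β → EuclideanSpace ℝ L}
    {F : α → β → L} {K δ : ℝ} (hK : 0 < K) (hX : ∑ a, X a = 0) (hY : ∑ b, Y b = 0)
    (hX4 : 𝔼 a, ‖X a‖ ^ 4 ≤ K * (𝔼 a, ‖X a‖ ^ 2) ^ 2)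
    (hY4 : 𝔼 b, ‖Y b‖ ^ 4 ≤ K * (𝔼 b, ‖Y b‖ ^ 2) ^ 2)
    (hδ : 𝔼 a, 𝔼 b, ‖c + X a + Y b - oneHot (F a b)‖ ^ 2 ≤ δ) :
    min (𝔼 a, ‖X a‖ ^ 2) (𝔼 b, ‖Y b‖ ^ 2) ≤ 576 * K * δ := by
  have h := min_expect_le (U := fun p : α × α => ‖X p.1 - X p.2‖ ^ 2)
    (V := fun p : β × β => ‖Y p.1 - Y p.2‖ ^ 2) (K := 4 * K) (by positivity)
    (fun _ => by positivity) (fun _ => by positivity)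
    (by
      rw [expect_norm_sub_sq hX]
      refine (expect_norm_sub_pow_four X).trans ?_
      linarith)
    (by
      rw [expect_norm_sub_sq hY]
      refine (expect_norm_sub_pow_four Y).trans ?_
      linarith)
  rw [expect_norm_sub_sq hX, expect_norm_sub_sq hY, ← mul_min_of_nonneg _ _ zero_le_two] at h
  have hT : 𝔼 p : α × α, 𝔼 q : β × β,
      min (‖X p.1 - X p.2‖ ^ 2) (‖Y q.1 - Y q.2‖ ^ 2) ≤ 144 * δ := by
    calc _ ≤ 𝔼 p : α × α, 𝔼 q : β × β, 36 * (‖c + X p.1 + Y q.1 - oneHot (F p.1 q.1)‖ ^ 2 +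
            ‖c + X p.1 + Y q.2 - oneHot (F p.1 q.2)‖ ^ 2 +
            ‖c + X p.2 + Y q.1 - oneHot (F p.2 q.1)‖ ^ 2 +
            ‖c + X p.2 + Y q.2 - oneHot (F p.2 q.2)‖ ^ 2) :=
          Finset.expect_le_expect fun p _ => Finset.expect_le_expect fun q _ =>
            min_norm_sub_sq_le c X Y F p.1 p.2 q.1 q.2
      _ = 36 * (4 * 𝔼 a, 𝔼 b, ‖c + X a + Y b - oneHot (F a b)‖ ^ 2) := by
          simp_rw [← Finset.univ_product_univ, Finset.expect_product, ← Finset.mul_expect,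
            Finset.expect_add_distrib, Fintype.expect_const]
          ring
      _ ≤ _ := by linarith
  nlinarith

end Block

/-! ### Moments of independent sums, and isolating a heavy coordinate -/

section Sums
variable {ι Ω E : Type*} [Fintype ι] [DecidableEq ι] [Fintype Ω] [Nonempty Ω]
  [NormedAddCommGroup E] [InnerProductSpace ℝ E]

lemma expect_inner_sum_coord {h : ι → Ω → E} (h0 : ∀ i, ∑ z, h i z = 0) (s : Finset ι) (v : E) :
    𝔼 x : ι → Ω, inner ℝ (∑ i ∈ s, h i (x i)) v = 0 := by
  simp_rw [sum_inner]
  rw [Finset.expect_sum_comm]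
  refine Finset.sum_eq_zero fun i _ => ?_
  rw [expect_coord i fun z => inner ℝ (h i z) v, expect_inner_left (h0 i)]

lemma sum_sum_coord {h : ι → Ω → E} (h0 : ∀ i, ∑ z, h i z = 0) (s : Finset ι) :
    ∑ x : ι → Ω, ∑ i ∈ s, h i (x i) = 0 := by
  refine ext_inner_right ℝ fun v => ?_
  have := expect_inner_sum_coord h0 s v
  rw [Fintype.expect_eq_sum_div_card, div_eq_zero_iff, or_iff_left (by simp), ← sum_inner] at this
  rw [this, inner_zero_left]

/-- Second and fourth moments of a sum of independent centred random vectors. -/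
lemma moments_sum_coord {h : ι → Ω → E} {K : ℝ} (hK : 3 ≤ K) (h0 : ∀ i, ∑ z, h i z = 0)
    (h4 : ∀ i, 𝔼 z, ‖h i z‖ ^ 4 ≤ K * (𝔼 z, ‖h i z‖ ^ 2) ^ 2) (s : Finset ι) :
    𝔼 x : ι → Ω, ‖∑ i ∈ s, h i (x i)‖ ^ 2 = ∑ i ∈ s, 𝔼 z, ‖h i z‖ ^ 2 ∧
    𝔼 x : ι → Ω, ‖∑ i ∈ s, h i (x i)‖ ^ 4 ≤ K * (∑ i ∈ s, 𝔼 z, ‖h i z‖ ^ 2) ^ 2 := by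
  induction s using Finset.induction_on with
  | empty => simp
  | insert i s his ih =>
    obtain ⟨ih2, ih4⟩ := ih
    have hupd : ∀ (x : ι → Ω) z,
        ∑ l ∈ insert i s, h l (Function.update x i z l) = ∑ l ∈ s, h l (x l) + h i z := by
      intro x z
      rw [Finset.sum_insert his, Function.update_self, add_comm]
      congr 1
      refine Finset.sum_congr rfl fun l hl => ?_
      rw [Function.update_of_ne (ne_of_mem_of_not_mem hl his)]
    have hsplit : ∀ φ : E → ℝ, 𝔼 x : ι → Ω, φ (∑ l ∈ insert i s, h l (x l)) =
        𝔼 x : ι → Ω, 𝔼 z, φ (∑ l ∈ s, h l (x l) + h i z) := by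
      intro φ
      rw [← expect_update i]
      simp_rw [hupd]
    have hc : ∀ v, 𝔼 z, inner ℝ v (h i z) = 0 := fun v =>
      (Finset.expect_congr rfl fun z _ => real_inner_comm _ _).trans (expect_inner_left (h0 i) v)
    have e2 := hsplit fun v => ‖v‖ ^ 2
    simp only [norm_add_sq_real, Finset.expect_add_distrib, ← Finset.mul_expect,
      Fintype.expect_const, hc, mul_zero, add_zero] at e2
    refine ⟨by rw [e2, Finset.sum_insert his, ih2, add_comm], ?_⟩
    rw [hsplit fun v => ‖v‖ ^ 4, Finset.sum_insert his]
    set S := ∑ l ∈ s, 𝔼 z, ‖h l z‖ ^ 2 with hS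
    set T := 𝔼 z, ‖h i z‖ ^ 2 with hT
    have hS0 : 0 ≤ S := Finset.sum_nonneg fun _ _ => Finset.expect_nonneg fun _ _ => by positivity
    have hT0 : 0 ≤ T := Finset.expect_nonneg fun _ _ => by positivity
    have hx : 𝔼 x : ι → Ω, 𝔼 z, 4 * (inner ℝ (∑ l ∈ s, h l (x l)) (h i z) * ‖h i z‖ ^ 2) = 0 := by
      rw [Finset.expect_comm]
      refine Finset.expect_eq_zero fun z _ => ?_
      rw [← Finset.mul_expect, ← Finset.expect_mul, expect_inner_sum_coord h0]
      simp
    calc 𝔼 x : ι → Ω, 𝔼 z, ‖∑ l ∈ s, h l (x l) + h i z‖ ^ 4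
        ≤ 𝔼 x : ι → Ω, 𝔼 z, (‖∑ l ∈ s, h l (x l)‖ ^ 4 + ‖h i z‖ ^ 4 +
          6 * (‖∑ l ∈ s, h l (x l)‖ ^ 2 * ‖h i z‖ ^ 2) +
          4 * (‖∑ l ∈ s, h l (x l)‖ ^ 2 * inner ℝ (∑ l ∈ s, h l (x l)) (h i z)) +
          4 * (inner ℝ (∑ l ∈ s, h l (x l)) (h i z) * ‖h i z‖ ^ 2)) := by
          refine Finset.expect_le_expect fun x _ => Finset.expect_le_expect fun z _ => ?_
          set f := ∑ l ∈ s, h l (x l)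
          -- Cauchy–Schwarz turns the squared inner product into a multiple of `‖f‖² ‖h i z‖²`: the
          -- factor `6` is `2 + 4`. The two odd terms average to zero.
          have hcs : inner ℝ f (h i z) ^ 2 ≤ ‖f‖ ^ 2 * ‖h i z‖ ^ 2 := by
            rw [← mul_pow, ← sq_abs]
            exact pow_le_pow_left₀ (abs_nonneg _) (abs_real_inner_le_norm _ _) 2
          rw [show ‖f + h i z‖ ^ 4 = (‖f + h i z‖ ^ 2) ^ 2 by ring, norm_add_sq_real]
          nlinarith
      _ = 𝔼 x : ι → Ω, ‖∑ l ∈ s, h l (x l)‖ ^ 4 + 𝔼 z, ‖h i z‖ ^ 4 + 6 * (S * T) := by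
          simp_rw [Finset.expect_add_distrib] at hx ⊢
          rw [hx]
          simp_rw [← Finset.mul_expect, hc, Fintype.expect_const, mul_zero, ← Finset.expect_mul]
          rw [ih2, hT]
          simp only [Finset.expect_const_zero, mul_zero, add_zero]
      _ ≤ K * S ^ 2 + K * T ^ 2 + 6 * (S * T) := by gcongr; exact h4 i
      -- Here `3 ≤ K` is needed, for `6 ≤ 2 * K`.
      _ ≤ K * (T + S) ^ 2 := by nlinarith [mul_nonneg hS0 hT0]

/-- Add indices to `s` one by one until the weight outside first drops to `η` or less. Just before
the last index the outside was heavy, hence `s` weighed at most `η`; just after it the rest weighs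
at most `η`. The last index is the one sought. -/
lemma exists_sum_erase_le {w : ι → ℝ} (hw : ∀ i, 0 ≤ w i) {η : ℝ} [Nonempty ι]
    (h : ∀ s : Finset ι, min (∑ i ∈ s, w i) (∑ i ∈ sᶜ, w i) ≤ η) :
    ∃ i, ∑ l ∈ Finset.univ.erase i, w l ≤ 2 * η := by
  have hη : 0 ≤ η := (le_min (Finset.sum_nonneg fun i _ => hw i)
    (Finset.sum_nonneg fun i _ => hw i)).trans (h ∅)
  have key : ∀ s : Finset ι, η < ∑ i ∈ sᶜ, w i ∨
      ∃ i, ∑ l ∈ Finset.univ.erase i, w l ≤ 2 * η := by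
    intro s
    induction s using Finset.induction_on with
    | empty =>
      by_cases hW : η < ∑ i ∈ (∅ : Finset ι)ᶜ, w i
      · exact Or.inl hW
      · refine Or.inr ⟨Classical.arbitrary ι, ?_⟩
        rw [Finset.compl_empty] at hW
        have := Finset.sum_le_univ_sum_of_nonneg hw (s := Finset.univ.erase (Classical.arbitrary ι))
        linarith
    | insert a s has ih =>
      rcases ih with ih | ih
      · by_cases hW : η < ∑ i ∈ (insert a s)ᶜ, w i
        · exact Or.inl hW
        · refine Or.inr ⟨a, ?_⟩
          have h1 : ∑ i ∈ s, w i ≤ η := by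
            rcases min_le_iff.1 (h s) with h1 | h1
            · exact h1
            · linarith
          have h2 : Finset.univ.erase a = s ∪ (insert a s)ᶜ := by
            ext i
            by_cases hi : i = a
            · simp [hi, has]
            · simp [hi, em]
          have h3 : Disjoint s (insert a s)ᶜ := by
            rw [Finset.disjoint_left]; intro i hi; simp [hi]
          rw [h2, Finset.sum_union h3]
          linarith
      · exact Or.inr ih
  rcases key Finset.univ with h1 | h1
  · simp at h1; linarith
  · exact h1

end Sums

/-- If a one-hot function is close to a sum of independent centred contributions, then one
coordinate accounts for almost all of the variance. -/
theorem exists_dominant_coord {ι Ω L : Type*} [Fintype ι] [DecidableEq ι] [Nonempty ι] [Fintype Ω]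
    [Nonempty Ω] [Fintype L] [DecidableEq L] {h : ι → Ω → EuclideanSpace ℝ L} {K δ : ℝ}
    {c : EuclideanSpace ℝ L} {F : (ι → Ω) → L} (hK : 3 ≤ K) (h0 : ∀ i, ∑ z, h i z = 0)
    (h4 : ∀ i, 𝔼 z, ‖h i z‖ ^ 4 ≤ K * (𝔼 z, ‖h i z‖ ^ 2) ^ 2)
    (hδ : 𝔼 x : ι → Ω, ‖c + ∑ i, h i (x i) - oneHot (F x)‖ ^ 2 ≤ δ) :
    ∃ i, ∑ l ∈ Finset.univ.erase i, 𝔼 z, ‖h l z‖ ^ 2 ≤ 2 * (576 * K * δ) := by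
  refine exists_sum_erase_le (fun i => Finset.expect_nonneg fun _ _ => by positivity) fun s => ?_
  let e := Equiv.piEquivPiSubtypeProd (· ∈ s) fun _ : ι => Ω
  have hX := moments_sum_coord (h := fun i : {i // i ∈ s} => h i) hK (fun i => h0 i)
    (fun i => h4 i) Finset.univ
  have hY := moments_sum_coord (h := fun i : {i // i ∉ s} => h i) hK (fun i => h0 i)
    (fun i => h4 i) Finset.univ
  have hsX : ∑ i : {i // i ∈ s}, 𝔼 z, ‖h i z‖ ^ 2 = ∑ i ∈ s, 𝔼 z, ‖h i z‖ ^ 2 :=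
    Finset.sum_coe_sort s fun i => 𝔼 z, ‖h i z‖ ^ 2
  have hsY : ∑ i : {i // i ∉ s}, 𝔼 z, ‖h i z‖ ^ 2 = ∑ i ∈ sᶜ, 𝔼 z, ‖h i z‖ ^ 2 :=
    (Finset.sum_subtype sᶜ (by simp) fun i => 𝔼 z, ‖h i z‖ ^ 2).symm
  have hm := min_variance_le (c := c) (K := K) (δ := δ) (F := fun a b => F (e.symm (a, b)))
    (by linarith)
    (sum_sum_coord (h := fun i : {i // i ∈ s} => h i) (fun i => h0 i) Finset.univ)
    (sum_sum_coord (h := fun i : {i // i ∉ s} => h i) (fun i => h0 i) Finset.univ)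
    (by rw [hX.1]; exact hX.2) (by rw [hY.1]; exact hY.2)
    (by
      rw [← Finset.expect_product', Finset.univ_product_univ]
      refine le_of_eq_of_le (Eq.symm ?_) hδ
      refine Fintype.expect_equiv e _ _ fun x => ?_
      rw [← Fintype.sum_subtype_add_sum_subtype (· ∈ s), ← add_assoc]
      have he : e.symm ((e x).1, (e x).2) = x := e.symm_apply_apply x
      simp only [he]
      congr!)
  rwa [hX.1, hY.1, hsX, hsY] at hm

/-! ### From resampling one vote to resampling all votes -/

lemma ite_ne_triangle {L : Type*} [DecidableEq L] (a b c : L) :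
    (if a ≠ c then (1 : ℝ) else 0) ≤
      (if a ≠ b then (1 : ℝ) else 0) + if b ≠ c then (1 : ℝ) else 0 := by
  by_cases h1 : a = b
  · simp [h1]
  · rw [if_pos h1]
    split_ifs <;> norm_num

/-- A hybrid argument: the coordinates are moved one at a time. Moving the coordinates in `s`
preserves the uniform measure, so each further step costs as much as a single change at a uniform
profile. -/
lemma expect_ne_piecewise_smul_le {ι Ω G L : Type*} [Fintype ι] [DecidableEq ι] [Fintype Ω]
    [Group G] [Fintype G] [MulAction G Ω] [DecidableEq L] (F : (ι → Ω) → L) (s : Finset ι) :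
    𝔼 σ : ι → G, 𝔼 x : ι → Ω,
        (if F x ≠ F (s.piecewise (fun i => σ i • x i) x) then (1 : ℝ) else 0) ≤
      ∑ i ∈ s, 𝔼 σ : G, 𝔼 x : ι → Ω,
        if F x ≠ F (Function.update x i (σ • x i)) then (1 : ℝ) else 0 := by
  induction s using Finset.induction_on with
  | empty => simp
  | insert i s his ih =>
    rw [Finset.sum_insert his, add_comm]
    have hstep : 𝔼 σ : G, 𝔼 x : ι → Ω,
        (if F x ≠ F (Function.update x i (σ • x i)) then (1 : ℝ) else 0) =
        𝔼 σ : ι → G, 𝔼 x : ι → Ω, if F (s.piecewise (fun i => σ i • x i) x) ≠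
          F ((insert i s).piecewise (fun i => σ i • x i) x) then (1 : ℝ) else 0 := by
      rw [← expect_coord i fun σ : G => 𝔼 x : ι → Ω,
        if F x ≠ F (Function.update x i (σ • x i)) then (1 : ℝ) else 0]
      refine Finset.expect_congr rfl fun σ _ => ?_
      let e : (ι → Ω) ≃ (ι → Ω) := Equiv.piCongrRight fun l =>
        if l ∈ s then MulAction.toPerm (σ l) else Equiv.refl _
      have he : ∀ x, e x = s.piecewise (fun i => σ i • x i) x := by
        intro x
        ext l
        by_cases hl : l ∈ s <;> simp [e, hl]
      symm
      refine Fintype.expect_equiv e _ _ fun x => ?_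
      rw [he, Finset.piecewise_insert]
      have : s.piecewise (fun i => σ i • x i) x i = x i := Finset.piecewise_eq_of_notMem _ _ _ his
      rw [this]
    rw [hstep]
    refine le_trans ?_ (add_le_add_left ih _)
    rw [← Finset.expect_add_distrib]
    refine Finset.expect_le_expect fun σ _ => ?_
    rw [← Finset.expect_add_distrib]
    exact Finset.expect_le_expect fun x _ => ite_ne_triangle _ _ _

lemma expect_ne_smul_le {ι Ω G L : Type*} [Fintype ι] [DecidableEq ι] [Fintype Ω]
    [Group G] [Fintype G] [MulAction G Ω] [DecidableEq L] (F : (ι → Ω) → L) :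
    𝔼 σ : ι → G, 𝔼 x : ι → Ω, (if F x ≠ F (fun i => σ i • x i) then (1 : ℝ) else 0) ≤
      ∑ i, 𝔼 σ : G, 𝔼 x : ι → Ω,
        if F x ≠ F (Function.update x i (σ • x i)) then (1 : ℝ) else 0 := by
  simpa using expect_ne_piecewise_smul_le (G := G) F Finset.univ

/-! ### Resampling a vote while the rank of one alternative is kept -/

section Stabilizer
variable {ι α L : Type*} [Fintype ι] [DecidableEq ι] [Fintype α] [DecidableEq α] [DecidableEq L]

/-- The permutations of the names that fix the name `j`. -/
abbrev Stab (j : α) : Subgroup (Equiv.Perm α) := MulAction.stabilizer (Equiv.Perm α) j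

/-- The probability that `F` changes when voter `i` resamples their vote, keeping the rank of
`j`. -/
noncomputable def influence (F : (ι → Equiv.Perm α) → L) (j : α) (i : ι) : ℝ :=
  𝔼 σ : Stab j, 𝔼 x : ι → Equiv.Perm α,
    if F x ≠ F (Function.update x i (σ • x i)) then (1 : ℝ) else 0

/-- A function with small total influence given the ranks of `j` is close to a function of the
ranks of `j`. -/
lemma exists_near_function_of_ranks (F : (ι → Equiv.Perm α) → L) (j : α) :
    ∃ G : (ι → α) → L, 𝔼 x : ι → Equiv.Perm α,
      (if F x ≠ G (fun i => (x i)⁻¹ j) then (1 : ℝ) else 0) ≤ ∑ i, influence F j i := by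
  have h := expect_ne_smul_le (G := Stab j) F
  rw [Finset.expect_comm] at h
  -- Each `x i` is a member of `Stab j` times the transposition `Equiv.swap j ((x i)⁻¹ j)`. A
  -- uniform `σ` absorbs that member, and what remains depends on the ranks of `j` only.
  have key : ∀ x : ι → Equiv.Perm α,
      𝔼 σ : ι → Stab j, (if F x ≠ F (fun i => σ i • x i) then (1 : ℝ) else 0) =
      𝔼 σ : ι → Stab j,
        if F x ≠ F (fun i => σ i • Equiv.swap j ((x i)⁻¹ j)) then (1 : ℝ) else 0 := by
    intro x
    let τ : ι → Stab j := fun i => ⟨x i * Equiv.swap j ((x i)⁻¹ j), by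
      rw [MulAction.mem_stabilizer_iff, Equiv.Perm.smul_def]
      simp⟩
    refine Fintype.expect_equiv (Equiv.mulRight τ) _ _ fun σ => ?_
    have : ∀ i, σ i • x i = (σ * τ) i • Equiv.swap j ((x i)⁻¹ j) := by
      intro i
      rw [Pi.mul_apply, mul_smul]
      congr 1
      rw [Subgroup.smul_def, smul_eq_mul]
      simp [τ, mul_assoc]
    simp only [this]
    rfl
  simp_rw [key] at h
  rw [Finset.expect_comm] at h
  -- Some fixed `σ` does at least as well as the average; it defines `G`.
  obtain ⟨σ, -, hσ⟩ := Finset.exists_le_of_expect_le Finset.univ_nonempty h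
  exact ⟨fun a => F fun i => σ i • Equiv.swap j (a i), hσ⟩

/-- The rankings that agree with `y` on the rank of `j` form the orbit of `y` under `Stab j`, on
which the stabilizer acts freely; they are a fraction `1/m` of all rankings. -/
lemma expect_ite_inv_apply_eq (j : α) (y : Equiv.Perm α) (ψ : Equiv.Perm α → ℝ) :
    𝔼 z : Equiv.Perm α, (if y⁻¹ j = z⁻¹ j then ψ z else 0) =
      (Fintype.card α : ℝ)⁻¹ * 𝔼 σ : Stab j, ψ (σ • y) := by
  have hsum : ∀ ψ : Equiv.Perm α → ℝ,
      ∑ z : Equiv.Perm α, (if y⁻¹ j = z⁻¹ j then ψ z else 0) = ∑ σ : Stab j, ψ (σ • y) := by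
    intro ψ
    rw [← Finset.sum_filter]
    symm
    refine Finset.sum_bij (fun σ _ => σ • y) ?_ ?_ ?_ fun _ _ => rfl
    · intro σ _
      have hσ : (σ : Equiv.Perm α)⁻¹ j = j := by
        rw [Equiv.Perm.inv_eq_iff_eq]; exact (MulAction.mem_stabilizer_iff.1 σ.2).symm
      rw [Finset.mem_filter, Subgroup.smul_def, smul_eq_mul, mul_inv_rev, Equiv.Perm.mul_apply, hσ]
      exact ⟨Finset.mem_univ _, rfl⟩
    · intro σ _ τ _ h
      rw [Subgroup.smul_def, Subgroup.smul_def, smul_eq_mul, smul_eq_mul] at h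
      exact Subtype.ext (mul_right_cancel h)
    · intro z hz
      rw [Finset.mem_filter] at hz
      refine ⟨⟨z * y⁻¹, ?_⟩, Finset.mem_univ _, ?_⟩
      · rw [MulAction.mem_stabilizer_iff, Equiv.Perm.smul_def, Equiv.Perm.mul_apply, hz.2]
        simp
      · simp [Subgroup.smul_def]
  have hcard := expect_inv_apply j fun r => if y⁻¹ j = r then (1 : ℝ) else 0
  rw [Fintype.expect_eq_sum_div_card, hsum fun _ => 1, Fintype.expect_eq_sum_div_card] at hcard
  simp only [Finset.sum_const, Finset.sum_ite_eq, Finset.mem_univ, if_true, nsmul_eq_mul, mul_one,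
    Finset.card_univ] at hcard
  rw [Fintype.expect_eq_sum_div_card, Fintype.expect_eq_sum_div_card, hsum]
  have h1 : (Fintype.card (Stab j) : ℝ) ≠ 0 := Nat.cast_ne_zero.2 Fintype.card_ne_zero
  have h2 : (Fintype.card (Equiv.Perm α) : ℝ) ≠ 0 := by simp
  have : Nonempty α := ⟨j⟩
  have h3 : (Fintype.card α : ℝ) ≠ 0 := by simp
  rw [div_eq_div_iff h2 h3] at hcard
  field_simp
  linear_combination (∑ σ : Stab j, ψ (σ • y)) * hcard

end Stabilizer

/-! ### Fourier expansion on a power of a finite set -/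

section Gram
variable {S X E : Type*} [DecidableEq S] [Fintype X] [NormedAddCommGroup E] [InnerProductSpace ℝ E]

lemma expect_inner_sum_smul {f g : S → X → ℝ} {w : S → ℝ}
    (h : ∀ s t, 𝔼 x, f s x * g t x = if s = t then w s else 0) (T : Finset S) (c d : S → E) :
    𝔼 x, inner ℝ (∑ s ∈ T, f s x • c s) (∑ t ∈ T, g t x • d t) =
      ∑ s ∈ T, w s * inner ℝ (c s) (d s) := by
  simp_rw [sum_inner, inner_sum, real_inner_smul_left, real_inner_smul_right]
  rw [Finset.expect_sum_comm]
  refine Finset.sum_congr rfl fun s hs => ?_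
  rw [Finset.expect_sum_comm]
  simp_rw [← mul_assoc, ← Finset.expect_mul, h, ite_mul, zero_mul]
  rw [Finset.sum_ite_eq, if_pos hs]

lemma expect_norm_sum_smul_sq {f : S → X → ℝ}
    (h : ∀ s t, 𝔼 x, f s x * f t x = if s = t then 1 else 0) (T : Finset S) (c : S → E) :
    𝔼 x, ‖∑ s ∈ T, f s x • c s‖ ^ 2 = ∑ s ∈ T, ‖c s‖ ^ 2 := by
  simp_rw [← real_inner_self_eq_norm_sq]
  rw [expect_inner_sum_smul (w := fun _ => 1) h]
  simp

end Gram

section Basis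
variable {α : Type*} [Fintype α] [DecidableEq α]

/-- A basis of the real functions on `α` that is orthonormal for the uniform measure, has the
constant function `1` at the index `o`, and is indexed by `α`. -/
structure IsUnitalBasis (o : α) (e : α → α → ℝ) : Prop where
  apply_base : ∀ a, e o a = 1
  expect_mul : ∀ s t, 𝔼 a, e s a * e t a = if s = t then 1 else 0
  sum_mul : ∀ a b, ∑ s, e s a * e s b = if a = b then (Fintype.card α : ℝ) else 0

lemma exists_isUnitalBasis (o : α) : ∃ e, IsUnitalBasis o e := by
  have : Nonempty α := ⟨o⟩
  set m : ℝ := (Fintype.card α : ℝ) with hm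
  have hm0 : 0 < m := by simp [hm, Fintype.card_pos]
  have hs : √m * √m = m := Real.mul_self_sqrt hm0.le
  have hs0 : √m ≠ 0 := (Real.sqrt_pos.2 hm0).ne'
  -- The normalised constant vector is extended to an orthonormal basis; scaling by `√m` passes to
  -- the uniform measure.
  let v : α → EuclideanSpace ℝ α := fun _ => WithLp.toLp 2 fun _ => (√m)⁻¹
  have hv : Orthonormal ℝ (({o} : Set α).domRestrict v) := by
    refine ⟨fun i => ?_, fun i j hij => (hij (Subsingleton.elim _ _)).elim⟩
    rw [← sq_eq_sq₀ (norm_nonneg _) zero_le_one, EuclideanSpace.norm_sq_eq]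
    change ∑ _x : α, ‖(√m)⁻¹‖ ^ 2 = 1 ^ 2
    simp [inv_pow, Real.sq_sqrt hm0.le, ← hm, hm0.ne']
  obtain ⟨b, hb⟩ := hv.exists_orthonormalBasis_extension_of_card_eq (by simp)
  refine ⟨fun s a => √m * b s a, fun a => ?_, fun s t => ?_, fun x y => ?_⟩
  · rw [hb o rfl]
    simp [v, hs0]
  · have h := b.inner_eq_ite t s
    rw [PiLp.inner_apply] at h
    have hsum : ∑ a, √m * b s a * (√m * b t a) = m * if s = t then 1 else 0 := by
      rw [show (if s = t then (1 : ℝ) else 0) = if t = s then 1 else 0 by simp [eq_comm], ← h,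
        Finset.mul_sum]
      refine Finset.sum_congr rfl fun a _ => ?_
      simp only [RCLike.inner_apply, conj_trivial]
      linear_combination (b s a * b t a) * hs
    rw [Fintype.expect_eq_sum_div_card, hsum, ← hm, mul_div_cancel_left₀ _ hm0.ne']
  · have h := b.sum_inner_mul_inner (EuclideanSpace.single x (1 : ℝ)) (EuclideanSpace.single y 1)
    simp only [EuclideanSpace.inner_single_left, EuclideanSpace.inner_single_right] at h
    simp only [map_one, one_mul, conj_trivial, PiLp.single_apply] at h
    rw [show (if x = y then m else 0) = m * if y = x then 1 else 0 by simp [eq_comm], ← h, Finset.mul_sum]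
    refine Finset.sum_congr rfl fun s _ => ?_
    linear_combination (b s x * b s y) * hs

variable {o : α} {e : α → α → ℝ}

lemma IsUnitalBasis.sum_eq_zero (he : IsUnitalBasis o e) {t : α} (ht : t ≠ o) :
    ∑ a, e t a = 0 := by
  have : Nonempty α := ⟨o⟩
  have h := he.expect_mul t o
  simp_rw [he.apply_base, mul_one] at h
  rw [if_neg ht, Fintype.expect_eq_sum_div_card, div_eq_zero_iff] at h
  exact h.resolve_right (by simp)

lemma IsUnitalBasis.expect_inv_apply_mul (he : IsUnitalBasis o e) (hm : 1 < Fintype.card α)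
    (j k s t : α) : 𝔼 y : Equiv.Perm α, e s (y⁻¹ j) * e t (y⁻¹ k) =
      if s = t then (if j = k ∨ s = o then 1 else -((Fintype.card α : ℝ) - 1)⁻¹) else 0 := by
  by_cases hjk : j = k
  · subst hjk
    rw [expect_inv_apply j fun a => e s a * e t a, he.expect_mul]
    simp
  by_cases ht : t = o
  · subst ht
    simp_rw [he.apply_base, mul_one]
    rw [expect_inv_apply j (e s)]
    have h := he.expect_mul s t
    simp_rw [he.apply_base, mul_one] at h
    rw [h]
    split_ifs with h1 h2
    · rfl
    · exact (h2 (Or.inr h1)).elim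
    · rfl
  have hm' : (0 : ℝ) < (Fintype.card α : ℝ) - 1 := by
    rw [sub_pos]; exact_mod_cast hm
  have h := expect_inv_apply_mul_inv_apply hjk (e s) (e t) (he.sum_eq_zero ht)
  rw [he.expect_mul, mul_comm, ← eq_div_iff hm'.ne'] at h
  rw [h]
  by_cases hst : s = t
  · subst hst
    simp [hjk, ht, neg_div]
  · simp [hst]

variable {ι : Type*} [Fintype ι] [DecidableEq ι]

/-- The product basis of the functions on `ι → α`. -/
def prodBasis (e : α → α → ℝ) (s a : ι → α) : ℝ := ∏ i, e (s i) (a i)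

/-- The number of coordinates on which a member of the product basis depends. -/
def weight (o : α) (s : ι → α) : ℕ := (Finset.univ.filter fun i => s i ≠ o).card

/-- The ranks of `j` in the votes of the profile `x`. -/
def ranks (x : ι → Equiv.Perm α) (j : α) : ι → α := fun i => (x i)⁻¹ j

/-- Votes are independent, so the correlation is a product over voters; for `j ≠ k` each voter with
a nonconstant factor contributes `-1/(m-1)`. -/
lemma expect_prodBasis_mul (he : IsUnitalBasis o e) (hm : 1 < Fintype.card α) (j k : α)
    (s t : ι → α) : 𝔼 x : ι → Equiv.Perm α, prodBasis e s (ranks x j) * prodBasis e t (ranks x k) =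
      if s = t then (if j = k then 1 else (-((Fintype.card α : ℝ) - 1)⁻¹) ^ weight o s)
      else 0 := by
  simp_rw [prodBasis, ← Finset.prod_mul_distrib, ranks]
  rw [expect_pi_prod fun i (y : Equiv.Perm α) => e (s i) (y⁻¹ j) * e (t i) (y⁻¹ k)]
  simp_rw [he.expect_inv_apply_mul hm]
  by_cases hst : s = t
  · subst hst
    simp only [if_true]
    by_cases hjk : j = k
    · simp [hjk]
    · simp only [hjk, false_or, if_false]
      rw [Finset.prod_ite]
      simp [weight]
  · obtain ⟨i, hi⟩ := Function.ne_iff.1 hst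
    rw [if_neg hst]
    exact Finset.prod_eq_zero (Finset.mem_univ i) (if_neg hi)

lemma expect_prodBasis_mul_self (he : IsUnitalBasis o e) (hm : 1 < Fintype.card α) (j : α)
    (s t : ι → α) : 𝔼 x : ι → Equiv.Perm α, prodBasis e s (ranks x j) * prodBasis e t (ranks x j) =
      if s = t then 1 else 0 := by
  simpa using expect_prodBasis_mul he hm j j s t

variable {E : Type*} [NormedAddCommGroup E] [InnerProductSpace ℝ E]

/-- The coefficients of a function on `ι → α` in the product basis. -/
noncomputable def coeff (e : α → α → ℝ) (u : (ι → α) → E) (s : ι → α) : E :=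
  (Fintype.card (ι → α) : ℝ)⁻¹ • ∑ a, prodBasis e s a • u a

lemma sum_prodBasis_smul_coeff (he : IsUnitalBasis o e) (u : (ι → α) → E) (a : ι → α) :
    ∑ s, prodBasis e s a • coeff e u s = u a := by
  have : Nonempty α := ⟨o⟩
  have hK : ∀ b : ι → α, ∑ s, prodBasis e s a * prodBasis e s b =
      if a = b then (Fintype.card (ι → α) : ℝ) else 0 := by
    intro b
    simp_rw [prodBasis, ← Finset.prod_mul_distrib]
    rw [← Fintype.prod_sum fun i s => e s (a i) * e s (b i)]
    simp_rw [he.sum_mul]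
    by_cases hab : a = b
    · subst hab; simp
    · obtain ⟨i, hi⟩ := Function.ne_iff.1 hab
      rw [if_neg hab]
      exact Finset.prod_eq_zero (Finset.mem_univ i) (if_neg hi)
  have hterm : ∀ s, prodBasis e s a • coeff e u s = ∑ b,
      ((Fintype.card (ι → α) : ℝ)⁻¹ * (prodBasis e s a * prodBasis e s b)) • u b := by
    intro s
    rw [coeff, smul_comm, Finset.smul_sum, Finset.smul_sum]
    simp_rw [smul_smul]
  simp_rw [hterm]
  rw [Finset.sum_comm]
  simp_rw [← Finset.sum_smul, ← Finset.mul_sum, hK]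
  simp

/-- Separates the constant term, the contributions of single voters, and the interactions that will
turn out to be small. -/
lemma sum_by_weight {M : Type*} [AddCommMonoid M] (o : α) (Φ : (ι → α) → M) :
    ∑ s, Φ s = Φ (fun _ => o) +
      ∑ i, ∑ t ∈ Finset.univ.erase o, Φ (Function.update (fun _ => o) i t) +
      ∑ s ∈ Finset.univ.filter fun s => 2 ≤ weight o s, Φ s := by
  have h0 : ∀ s : ι → α, weight o s = 0 ↔ s = fun _ => o := by
    intro s
    rw [weight, Finset.card_eq_zero, Finset.filter_eq_empty_iff]
    simp [funext_iff]
  have h1 : ∑ s ∈ Finset.univ.filter fun s => weight o s = 1, Φ s =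
      ∑ i, ∑ t ∈ Finset.univ.erase o, Φ (Function.update (fun _ => o) i t) := by
    rw [← Finset.sum_product']
    symm
    refine Finset.sum_bij (fun p _ => Function.update (fun _ => o) p.1 p.2) ?_ ?_ ?_ fun _ _ => rfl
    · rintro ⟨i, t⟩ hp
      have ht : t ≠ o := by simpa using hp
      simp only [Finset.mem_filter, Finset.mem_univ, true_and, weight, Finset.card_eq_one]
      refine ⟨i, ?_⟩
      ext l
      by_cases hl : l = i
      · subst hl; simp [ht]
      · simp [hl]
    · rintro ⟨i, t⟩ hp ⟨i', t'⟩ hp' heq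
      have ht : t ≠ o := by simpa using hp
      have hi : i = i' := by
        by_contra hne
        have := congrFun heq i
        simp [hne, ht] at this
      subst hi
      have := congrFun heq i
      simp only [Function.update_self] at this
      rw [this]
    · intro s hs
      simp only [Finset.mem_filter, Finset.mem_univ, true_and, weight, Finset.card_eq_one] at hs
      obtain ⟨i, hi⟩ := hs
      have hmem : ∀ l, s l ≠ o ↔ l = i := by
        intro l
        have := Finset.ext_iff.1 hi l
        simpa using this
      refine ⟨(i, s i), by simpa using (hmem i).2 rfl, ?_⟩
      ext l
      by_cases hl : l = i
      · subst hl; simp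
      · rw [Function.update_of_ne hl]
        by_contra hne
        exact hl ((hmem l).1 (Ne.symm hne))
  rw [← h1, ← Finset.sum_filter_add_sum_filter_not Finset.univ (fun s => 2 ≤ weight o s), add_comm]
  congr 1
  rw [← Finset.sum_filter_add_sum_filter_not _ (fun s => weight o s = 0), Finset.filter_filter,
    Finset.filter_filter]
  congr 1
  · rw [show (Finset.univ.filter fun s : ι → α => ¬2 ≤ weight o s ∧ weight o s = 0) =
      {fun _ => o} by
        ext s
        simp only [Finset.mem_filter, Finset.mem_univ, true_and, Finset.mem_singleton, ← h0 s]
        omega, Finset.sum_singleton]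
  · refine Finset.sum_congr ?_ fun _ _ => rfl
    ext s
    simp only [Finset.mem_filter, Finset.mem_univ, true_and]
    omega

lemma weight_base : weight o (fun _ : ι => o) = 0 := by simp [weight]

lemma weight_update {i : ι} {t : α} (ht : t ≠ o) :
    weight o (Function.update (fun _ => o) i t) = 1 := by
  rw [weight, Finset.card_eq_one]
  refine ⟨i, ?_⟩
  ext l
  by_cases hl : l = i
  · subst hl; simp [ht]
  · simp [hl]

lemma prodBasis_base (he : IsUnitalBasis o e) (a : ι → α) : prodBasis e (fun _ => o) a = 1 := by
  simp [prodBasis, he.apply_base]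

lemma prodBasis_update (he : IsUnitalBasis o e) (i : ι) (t : α) (a : ι → α) :
    prodBasis e (Function.update (fun _ => o) i t) a = e t (a i) := by
  rw [prodBasis, Finset.prod_eq_single i]
  · simp
  · intro l _ hl
    simp [hl, he.apply_base]
  · simp

/-! ### Functions of the ranks of the alternatives with constant sum -/

lemma sum_sum_ite_inner (q : ℝ) (c : α → E) :
    ∑ j, ∑ k, (if j = k then 1 else q) * inner ℝ (c j) (c k) =
      (1 - q) * ∑ j, ‖c j‖ ^ 2 + q * ‖∑ j, c j‖ ^ 2 := by
  rw [← real_inner_self_eq_norm_sq (∑ j, c j), sum_inner, Finset.mul_sum, Finset.mul_sum,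
    ← Finset.sum_add_distrib]
  refine Finset.sum_congr rfl fun j _ => ?_
  rw [inner_sum, Finset.mul_sum, ← real_inner_self_eq_norm_sq]
  have : ∀ k, (if j = k then 1 else q) * inner ℝ (c j) (c k) =
      (if j = k then (1 - q) * inner ℝ (c j) (c k) else 0) + q * inner ℝ (c j) (c k) := by
    intro k
    split_ifs <;> ring
  simp_rw [this, Finset.sum_add_distrib]
  simp

lemma norm_sum_sq_le (c : α → E) :
    ‖∑ j, c j‖ ^ 2 ≤ (Fintype.card α : ℝ) * ∑ j, ‖c j‖ ^ 2 := by
  calc ‖∑ j, c j‖ ^ 2 ≤ (∑ j, ‖c j‖) ^ 2 := by gcongr; exact norm_sum_le _ _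
    _ ≤ _ := by simpa using sq_sum_le_card_mul_sum_sq (s := Finset.univ) (f := fun j => ‖c j‖)

/-- The form is `(1 - q) S + q T` with `0 ≤ T ≤ m S` and `|q| ≤ (m-1)⁻²`. For `q ≥ 0` it is at least
`3/4 * S`; for `q < 0` at least `(1 + q (m-1)) S`, hence at least `(1 - 1/(m-1)) S`, and `m ≥ 3`
makes this `S / 2` or more. -/
lemma sum_norm_sq_le_two_mul (hm : 3 ≤ Fintype.card α) {w : ℕ} (hw : 2 ≤ w) (c : α → E) :
    ∑ j, ‖c j‖ ^ 2 ≤ 2 * ∑ j, ∑ k,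
      (if j = k then 1 else (-((Fintype.card α : ℝ) - 1)⁻¹) ^ w) * inner ℝ (c j) (c k) := by
  rw [sum_sum_ite_inner]
  set m : ℝ := (Fintype.card α : ℝ) with hmdef
  have hm3 : (3 : ℝ) ≤ m := by rw [hmdef]; exact_mod_cast hm
  set S := ∑ j, ‖c j‖ ^ 2 with hS
  have hS0 : 0 ≤ S := Finset.sum_nonneg fun _ _ => by positivity
  have hT := norm_sum_sq_le c
  set q := (-(m - 1)⁻¹) ^ w with hq
  set p := (m - 1)⁻¹ with hp
  have hp0 : 0 ≤ p := inv_nonneg.2 (by linarith)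
  have hp1 : p ≤ 1 / 2 := by
    rw [hp, inv_le_comm₀ (by linarith) (by norm_num)]; norm_num; linarith
  have hpm : p * (m - 1) = 1 := inv_mul_cancel₀ (by linarith)
  have hqa : |q| ≤ p ^ 2 := by
    rw [hq, abs_pow, abs_neg, abs_of_nonneg hp0]
    exact pow_le_pow_of_le_one hp0 (by linarith) hw
  have hN : 0 ≤ ‖∑ j, c j‖ ^ 2 := by positivity
  by_cases hq0 : 0 ≤ q
  · rw [abs_of_nonneg hq0] at hqa
    have : q ≤ 1 / 4 := hqa.trans (by nlinarith)
    nlinarith [mul_nonneg hq0 hN, mul_nonneg (sub_nonneg.2 this) hS0]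
  · push Not at hq0
    rw [abs_of_neg hq0] at hqa
    have h1 : -q * ‖∑ j, c j‖ ^ 2 ≤ -q * (m * S) := by gcongr; linarith
    have h2 : -q * (m - 1) ≤ 1 / 2 := by
      calc -q * (m - 1) ≤ p ^ 2 * (m - 1) := by gcongr; linarith
        _ = p := by rw [sq, mul_assoc, hpm, mul_one]
        _ ≤ _ := hp1
    nlinarith [mul_nonneg (sub_nonneg.2 h2) hS0]

/-- At weight one the form equals `(m S - T) / (m-1)`, a multiple of the sum of all `‖c j - c k‖²`.
It vanishes on families constant in `j`, so only differences are controlled; this is the room left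
for dictators. -/
lemma norm_sub_sq_le_of_weight_one (hm : 1 < Fintype.card α) (c : α → E) (j k : α) :
    ‖c j - c k‖ ^ 2 ≤ 2 * (Fintype.card α : ℝ) * ∑ j, ∑ k,
      (if j = k then 1 else (-((Fintype.card α : ℝ) - 1)⁻¹) ^ 1) * inner ℝ (c j) (c k) := by
  rw [sum_sum_ite_inner]
  have hT := norm_sum_sq_le c
  have hdiff : ∑ j, ∑ k, ‖c j - c k‖ ^ 2 =
      2 * ((Fintype.card α : ℝ) * ∑ j, ‖c j‖ ^ 2 - ‖∑ j, c j‖ ^ 2) := by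
    simp_rw [norm_sub_sq_real, Finset.sum_add_distrib, Finset.sum_sub_distrib, ← Finset.mul_sum,
      ← inner_sum, ← sum_inner, real_inner_self_eq_norm_sq]
    simp [← Finset.mul_sum]
    ring
  have hle : ‖c j - c k‖ ^ 2 ≤ ∑ j, ∑ k, ‖c j - c k‖ ^ 2 :=
    (Finset.single_le_sum (f := fun k => ‖c j - c k‖ ^ 2) (fun _ _ => by positivity)
      (Finset.mem_univ k)).trans
    (Finset.single_le_sum (f := fun j => ∑ k, ‖c j - c k‖ ^ 2)
      (fun _ _ => Finset.sum_nonneg fun _ _ => by positivity) (Finset.mem_univ j))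
  rw [hdiff] at hle
  refine hle.trans ?_
  set m : ℝ := (Fintype.card α : ℝ) with hmdef
  have hm1 : (0 : ℝ) < m - 1 := by rw [sub_pos, hmdef]; exact_mod_cast hm
  set S := ∑ j, ‖c j‖ ^ 2
  set T := ‖∑ j, c j‖ ^ 2
  have : 2 * m * ((1 - (-(m - 1)⁻¹) ^ 1) * S + (-(m - 1)⁻¹) ^ 1 * T) =
      m / (m - 1) * (2 * (m * S - T)) := by
    field_simp
    ring
  rw [this]
  have h1 : 1 ≤ m / (m - 1) := by rw [le_div_iff₀ hm1]; linarith
  nlinarith [mul_nonneg (sub_nonneg.2 h1) (sub_nonneg.2 hT)]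

end Basis

/-! ### Coefficients of families whose sum is almost constant -/

section Core
variable {ι α : Type*} [Fintype ι] [DecidableEq ι] [Fintype α] [DecidableEq α]
  {o : α} {e : α → α → ℝ} {E : Type*} [NormedAddCommGroup E] [InnerProductSpace ℝ E]

lemma expect_norm_sum_sum_sq (he : IsUnitalBasis o e) (hm : 1 < Fintype.card α)
    (c : α → (ι → α) → E) :
    𝔼 x : ι → Equiv.Perm α, ‖∑ j, ∑ s, prodBasis e s (ranks x j) • c j s‖ ^ 2 =
      ∑ s, ∑ j, ∑ k, (if j = k then 1 else (-((Fintype.card α : ℝ) - 1)⁻¹) ^ weight o s) *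
        inner ℝ (c j s) (c k s) := by
  have hx : ∀ x : ι → Equiv.Perm α, ‖∑ j, ∑ s, prodBasis e s (ranks x j) • c j s‖ ^ 2 =
      ∑ j, ∑ k, inner ℝ (∑ s, prodBasis e s (ranks x j) • c j s)
        (∑ s, prodBasis e s (ranks x k) • c k s) := by
    intro x
    rw [← real_inner_self_eq_norm_sq, sum_inner]
    exact Finset.sum_congr rfl fun j _ => inner_sum _ _ _
  simp_rw [hx]
  rw [Finset.expect_sum_comm, Finset.sum_comm]
  refine Finset.sum_congr rfl fun j _ => ?_
  rw [Finset.expect_sum_comm, Finset.sum_comm]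
  refine Finset.sum_congr rfl fun k _ => ?_
  exact expect_inner_sum_smul (f := fun s x => prodBasis e s (ranks x j))
    (g := fun s x => prodBasis e s (ranks x k)) (expect_prodBasis_mul he hm j k) _ _ _

lemma sum_sum_ite_inner_nonneg (hm : 3 ≤ Fintype.card α) (w : ℕ) (c : α → E) :
    0 ≤ ∑ j, ∑ k, (if j = k then 1 else (-((Fintype.card α : ℝ) - 1)⁻¹) ^ w) *
      inner ℝ (c j) (c k) := by
  match w with
  | 0 =>
    rw [sum_sum_ite_inner]
    simp
  | 1 =>
    have : Nonempty α := Fintype.card_pos_iff.1 (by omega)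
    obtain ⟨j⟩ := this
    have h := norm_sub_sq_le_of_weight_one (by omega) c j j
    rw [sub_self, norm_zero, zero_pow two_ne_zero] at h
    have hpos : (0 : ℝ) < 2 * (Fintype.card α : ℝ) := by
      have : 0 < Fintype.card α := by omega
      positivity
    exact nonneg_of_mul_nonneg_right h hpos
  | w + 2 =>
    have h := sum_norm_sq_le_two_mul hm (Nat.le_add_left 2 w) c
    have : 0 ≤ ∑ j, ‖c j‖ ^ 2 := Finset.sum_nonneg fun _ _ => by positivity
    linarith

lemma coeff_bounds_of_sum_near_const (he : IsUnitalBasis o e) (hm : 3 ≤ Fintype.card α)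
    (u : α → (ι → α) → E) (κ : E) {δ : ℝ}
    (hδ : 𝔼 x : ι → Equiv.Perm α, ‖∑ j, u j (ranks x j) - κ‖ ^ 2 ≤ δ) (j k : α) :
    ∑ s ∈ Finset.univ.filter (fun s => 2 ≤ weight o s), ‖coeff e (u j) s‖ ^ 2 ≤ 2 * δ ∧
    ∑ i, ∑ t ∈ Finset.univ.erase o, ‖coeff e (u j) (Function.update (fun _ => o) i t) -
      coeff e (u k) (Function.update (fun _ => o) i t)‖ ^ 2 ≤ 2 * (Fintype.card α : ℝ) * δ := by
  have : Nonempty α := ⟨o⟩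
  have hm0 : (Fintype.card α : ℝ) ≠ 0 := Nat.cast_ne_zero.2 Fintype.card_ne_zero
  -- The constant `κ` is shared equally among the alternatives and affects only the coefficients of
  -- weight zero.
  let c : α → (ι → α) → E := fun j s =>
    coeff e (u j) s - if s = (fun _ => o) then (Fintype.card α : ℝ)⁻¹ • κ else 0
  have hc : ∀ x : ι → Equiv.Perm α,
      ∑ j, ∑ s, prodBasis e s (ranks x j) • c j s = ∑ j, u j (ranks x j) - κ := by
    intro x
    simp_rw [c, smul_sub, Finset.sum_sub_distrib, sum_prodBasis_smul_coeff he, smul_ite, smul_zero]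
    simp_rw [Finset.sum_ite_eq', Finset.mem_univ, if_true, prodBasis_base he]
    rw [Finset.sum_const, Finset.card_univ, ← Nat.cast_smul_eq_nsmul ℝ, smul_smul, smul_smul,
      mul_one, mul_inv_cancel₀ hm0, one_smul]
  simp_rw [← hc] at hδ
  obtain ⟨Q, hQ⟩ : ∃ Q : (ι → α) → ℝ, ∀ s, Q s = ∑ j, ∑ k, (if j = k then 1 else
      (-((Fintype.card α : ℝ) - 1)⁻¹) ^ weight o s) * inner ℝ (c j s) (c k s) :=
    ⟨_, fun _ => rfl⟩
  have hQ0 : ∀ s, 0 ≤ Q s := fun s => by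
    rw [hQ]; exact sum_sum_ite_inner_nonneg hm _ fun j => c j s
  have hδQ : ∑ s, Q s ≤ δ := by
    simp_rw [hQ]
    rwa [expect_norm_sum_sum_sq he (by omega)] at hδ
  rw [sum_by_weight o] at hδQ
  have n1 : 0 ≤ ∑ i, ∑ t ∈ Finset.univ.erase o, Q (Function.update (fun _ => o) i t) :=
    Finset.sum_nonneg fun i _ => Finset.sum_nonneg fun t _ => hQ0 _
  have n2 : 0 ≤ ∑ s ∈ Finset.univ.filter fun s : ι → α => 2 ≤ weight o s, Q s :=
    Finset.sum_nonneg fun s _ => hQ0 s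
  have n0 := hQ0 fun _ => o
  constructor
  · calc _ ≤ ∑ s ∈ Finset.univ.filter (fun s : ι → α => 2 ≤ weight o s), 2 * Q s := by
          refine Finset.sum_le_sum fun s hs => ?_
          have hw : 2 ≤ weight o s := (Finset.mem_filter.1 hs).2
          have hne : s ≠ fun _ => o := by rintro rfl; rw [weight_base] at hw; omega
          rw [hQ]
          refine le_trans ?_ (sum_norm_sq_le_two_mul hm hw fun j => c j s)
          refine le_trans ?_ (Finset.single_le_sum (f := fun j => ‖c j s‖ ^ 2)
            (fun _ _ => by positivity) (Finset.mem_univ j))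
          simp [c, hne]
      _ ≤ 2 * δ := by rw [← Finset.mul_sum]; linarith
  · calc _ ≤ ∑ i, ∑ t ∈ Finset.univ.erase o,
          2 * (Fintype.card α : ℝ) * Q (Function.update (fun _ => o) i t) := by
          refine Finset.sum_le_sum fun i _ => Finset.sum_le_sum fun t ht => ?_
          have ht' : t ≠ o := Finset.ne_of_mem_erase ht
          have hne : Function.update (fun _ => o) i t ≠ fun _ => o := fun h =>
            ht' (by simpa using congrFun h i)
          have h := norm_sub_sq_le_of_weight_one (by omega)
            (fun j => c j (Function.update (fun _ => o) i t)) j k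
          rw [hQ, weight_update ht']
          refine le_of_eq_of_le ?_ h
          simp only [c, if_neg hne, sub_zero]
      _ ≤ _ := by
          simp_rw [← Finset.mul_sum]
          exact mul_le_mul_of_nonneg_left (by linarith) (by positivity)

end Core

/-! ### One voter common to all alternatives -/

section Voter
variable {ι α L : Type*} [Fintype ι] [DecidableEq ι] [Nonempty ι] [Fintype α] [DecidableEq α]
  [Fintype L] [DecidableEq L] {o : α} {e : α → α → ℝ}

/-- A crude substitute for hypercontractivity: on a space of `m` points the ratio of the moments is
at most `m`. With `m ≥ 3` it supplies the `K` of `exists_dominant_coord`. -/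
lemma fourth_moment_le {E : Type*} [NormedAddCommGroup E] [Nonempty α] (h : α → E) :
    𝔼 r, ‖h r‖ ^ 4 ≤ (Fintype.card α : ℝ) * (𝔼 r, ‖h r‖ ^ 2) ^ 2 := by
  have hm : (0 : ℝ) < Fintype.card α := Nat.cast_pos.2 Fintype.card_pos
  have h2 : ∑ r, ‖h r‖ ^ 4 ≤ (∑ r, ‖h r‖ ^ 2) ^ 2 := by
    simp_rw [show ∀ r, ‖h r‖ ^ 4 = (‖h r‖ ^ 2) ^ 2 from fun r => by ring]
    exact Finset.sum_sq_le_sq_sum_of_nonneg fun _ _ => by positivity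
  rw [Fintype.expect_eq_sum_div_card, Fintype.expect_eq_sum_div_card, div_pow,
    div_le_iff₀ hm]
  refine h2.trans (le_of_eq ?_)
  field_simp

/-- One voter carries almost all of the first-order part of a one-hot function of the ranks of
`j` that is almost of first order. -/
lemma exists_dominant_voter (he : IsUnitalBasis o e) (hm : 3 ≤ Fintype.card α)
    (j : α) (G : (ι → α) → L) {δ : ℝ}
    (hδ : ∑ s ∈ Finset.univ.filter (fun s => 2 ≤ weight o s),
      ‖coeff e (fun a => oneHot (G a)) s‖ ^ 2 ≤ δ) :
    ∃ i : ι, ∑ l ∈ Finset.univ.erase i, ∑ t ∈ Finset.univ.erase o,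
      ‖coeff e (fun a => oneHot (G a)) (Function.update (fun _ => o) l t)‖ ^ 2 ≤
        1152 * (Fintype.card α : ℝ) * δ := by
  have : Nonempty α := ⟨o⟩
  set c := coeff e (fun a => oneHot (G a)) with hc
  let h : ι → α → EuclideanSpace ℝ L := fun i r =>
    ∑ t ∈ Finset.univ.erase o, e t r • c (Function.update (fun _ => o) i t)
  have hsq : ∀ i, 𝔼 y : Equiv.Perm α, ‖h i (y⁻¹ j)‖ ^ 2 =
      ∑ t ∈ Finset.univ.erase o, ‖c (Function.update (fun _ => o) i t)‖ ^ 2 := by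
    intro i
    rw [expect_inv_apply j fun r => ‖h i r‖ ^ 2]
    exact expect_norm_sum_smul_sq he.expect_mul _ _
  have hF := exists_dominant_coord (h := fun i (y : Equiv.Perm α) => h i (y⁻¹ j))
    (K := (Fintype.card α : ℝ)) (δ := δ) (c := c fun _ => o)
    (F := fun x : ι → Equiv.Perm α => G (ranks x j)) (by exact_mod_cast hm)
    (fun i => by
      simp_rw [h]
      rw [Finset.sum_comm]
      refine Finset.sum_eq_zero fun t ht => ?_
      rw [← Finset.sum_smul]
      have h0 := expect_inv_apply j (e t)
      rw [Fintype.expect_eq_sum_div_card, Fintype.expect_eq_sum_div_card,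
        he.sum_eq_zero (Finset.ne_of_mem_erase ht), zero_div, div_eq_zero_iff,
        or_iff_left (Nat.cast_ne_zero.2 Fintype.card_ne_zero)] at h0
      rw [h0, zero_smul])
    (fun i => by
      rw [expect_inv_apply j fun r => ‖h i r‖ ^ 4, expect_inv_apply j fun r => ‖h i r‖ ^ 2]
      exact fourth_moment_le _)
    (by
      refine le_of_eq_of_le ?_ hδ
      rw [← expect_norm_sum_smul_sq (expect_prodBasis_mul_self he (by omega) j)]
      refine Finset.expect_congr rfl fun x _ => ?_
      have hinv := sum_prodBasis_smul_coeff he (fun a => oneHot (G a)) (ranks x j)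
      rw [sum_by_weight o, ← hc] at hinv
      rw [← hinv, ← norm_neg]
      simp only [prodBasis_base he, one_smul, prodBasis_update he, h]
      congr 2
      simp only [ranks]
      abel)
  obtain ⟨i, hi⟩ := hF
  simp_rw [hsq] at hi
  exact ⟨i, hi.trans (by linarith)⟩

/-- If one-hot functions of the ranks of the single alternatives sum up to a constant
approximately, then all of them are approximately controlled by one voter, up to constants by a
common function of the rank. -/
theorem exists_common_voter (hm : 3 ≤ Fintype.card α) (G : α → (ι → α) → L)
    (κ : EuclideanSpace ℝ L) {δ : ℝ}
    (hδ : 𝔼 x : ι → Equiv.Perm α, ‖∑ j, oneHot (G j (ranks x j)) - κ‖ ^ 2 ≤ δ) :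
    ∃ (i : ι) (c h : α → EuclideanSpace ℝ L), ∀ j, 𝔼 x : ι → Equiv.Perm α,
      ‖oneHot (G j (ranks x j)) - (c j + h ((x i)⁻¹ j))‖ ^ 2 ≤
        4614 * (Fintype.card α : ℝ) * δ := by
  have : Nonempty α := Fintype.card_pos_iff.1 (by omega)
  obtain ⟨o⟩ := this
  obtain ⟨e, he⟩ := exists_isUnitalBasis o
  let C : α → (ι → α) → EuclideanSpace ℝ L := fun j => coeff e fun a => oneHot (G j a)
  have hB : ∀ j k, _ ∧ _ := coeff_bounds_of_sum_near_const he hm (fun j a => oneHot (G j a)) κ hδ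
  -- From here on `o` plays two roles: index of the constant basis function, and reference
  -- alternative that supplies the voter `i` and the common `h`.
  obtain ⟨i, hi⟩ := exists_dominant_voter he hm o (G o) (hB o o).1
  refine ⟨i, fun j => C j fun _ => o, fun r =>
    ∑ t ∈ Finset.univ.erase o, e t r • C o (Function.update (fun _ => o) i t), fun j => ?_⟩
  -- The coefficients of the error `oneHot (G j _) - (c j + h _)`: the approximation has the
  -- weight-zero term of `j` itself and the weight-one terms of `o` at voter `i`.
  let d : (ι → α) → EuclideanSpace ℝ L := fun s =>
    if 2 ≤ weight o s then C j s else if weight o s = 0 then 0 else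
      C j s - if s i ≠ o then C o s else 0
  have d0 : d (fun _ => o) = 0 := by simp [d, weight_base]
  have d1 : ∀ l t, t ∈ Finset.univ.erase o → d (Function.update (fun _ => o) l t) =
      C j (Function.update (fun _ => o) l t) -
        if l = i then C o (Function.update (fun _ => o) l t) else 0 := by
    intro l t ht
    have ht' := Finset.ne_of_mem_erase ht
    by_cases hl : l = i
    · subst hl; simp [d, weight_update ht', ht']
    · simp [d, weight_update ht', hl, Ne.symm hl]
  have d2 : ∀ s ∈ Finset.univ.filter (fun s => 2 ≤ weight o s), d s = C j s := fun s hs =>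
    if_pos (Finset.mem_filter.1 hs).2
  have hd : ∀ x : ι → Equiv.Perm α, oneHot (G j (ranks x j)) - ((C j fun _ => o) +
      ∑ t ∈ Finset.univ.erase o, e t ((x i)⁻¹ j) • C o (Function.update (fun _ => o) i t)) =
      ∑ s, prodBasis e s (ranks x j) • d s := by
    intro x
    rw [← sum_prodBasis_smul_coeff he (fun a => oneHot (G j a)) (ranks x j), sum_by_weight o,
      sum_by_weight o fun s => prodBasis e s (ranks x j) • d s, d0,
      Finset.sum_congr rfl fun l _ => Finset.sum_congr rfl fun t ht =>
        congrArg (prodBasis e _ (ranks x j) • ·) (d1 l t ht),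
      Finset.sum_congr rfl fun s hs => congrArg (prodBasis e s (ranks x j) • ·) (d2 s hs)]
    simp only [smul_sub, Finset.sum_sub_distrib, prodBasis_base he, one_smul, smul_zero, smul_ite,
      prodBasis_update he]
    have : ∑ l, ∑ t ∈ Finset.univ.erase o, (if l = i then
        e t (ranks x j l) • C o (Function.update (fun _ => o) l t) else 0) =
        ∑ t ∈ Finset.univ.erase o, e t ((x i)⁻¹ j) • C o (Function.update (fun _ => o) i t) := by
      rw [Finset.sum_eq_single i]
      · simp [ranks]
      · intro l _ hl; simp [hl]
      · simp
    rw [this]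
    simp only [C]
    abel
  simp_rw [hd]
  rw [expect_norm_sum_smul_sq (expect_prodBasis_mul_self he (by omega) j), sum_by_weight o, d0,
    Finset.sum_congr rfl fun s hs => congrArg (‖·‖ ^ 2) (d2 s hs)]
  have hδ0 : 0 ≤ δ := le_trans (Finset.expect_nonneg fun _ _ => by positivity) hδ
  have hm1 : (1 : ℝ) ≤ Fintype.card α := by exact_mod_cast (by omega : 1 ≤ Fintype.card α)
  have key : ∑ l, ∑ t ∈ Finset.univ.erase o, ‖d (Function.update (fun _ => o) l t)‖ ^ 2 ≤
      2 * (∑ l, ∑ t ∈ Finset.univ.erase o, ‖C j (Function.update (fun _ => o) l t) -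
        C o (Function.update (fun _ => o) l t)‖ ^ 2) +
      2 * ∑ l ∈ Finset.univ.erase i, ∑ t ∈ Finset.univ.erase o,
        ‖C o (Function.update (fun _ => o) l t)‖ ^ 2 := by
    have : ∑ l ∈ Finset.univ.erase i, ∑ t ∈ Finset.univ.erase o,
        ‖C o (Function.update (fun _ => o) l t)‖ ^ 2 = ∑ l, ∑ t ∈ Finset.univ.erase o,
        if l = i then 0 else ‖C o (Function.update (fun _ => o) l t)‖ ^ 2 := by
      rw [← Finset.add_sum_erase _ _ (Finset.mem_univ i)]
      simp only [if_true, Finset.sum_const_zero, zero_add]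
      refine Finset.sum_congr rfl fun l hl => ?_
      simp [Finset.ne_of_mem_erase hl]
    rw [this]
    simp_rw [Finset.mul_sum, ← Finset.sum_add_distrib]
    refine Finset.sum_le_sum fun l _ => Finset.sum_le_sum fun t ht => ?_
    rw [d1 l t ht]
    set A := C j (Function.update (fun _ => o) l t)
    set B := C o (Function.update (fun _ => o) l t)
    split_ifs with hl
    · nlinarith [norm_nonneg (A - B)]
    · have h1 : ‖A - 0‖ ≤ ‖A - B‖ + ‖B‖ := by
        calc ‖A - 0‖ = ‖(A - B) + B‖ := by simp
          _ ≤ _ := norm_add_le _ _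
      nlinarith [norm_nonneg (A - 0), sq_nonneg (‖A - B‖ - ‖B‖), norm_nonneg (A - B),
        norm_nonneg B]
  have hb2 := (hB j j).1
  have hb1 := (hB j o).2
  simp only [C] at key ⊢
  rw [norm_zero]
  -- Weight one gives `2 * 2mδ + 2 * 1152 * m * 2δ`, the higher weights `2δ`; together at most `4614
  -- mδ`.
  nlinarith [mul_nonneg hδ0 (sub_nonneg.2 hm1)]

end Voter

/-! ### Rounding to an exact rule -/

/-- If some `ψ j` separates `r` from `r'`, then every `s` has a label under `ψ j` different from
that of `r` or of `r'`. For this pair the first alternative fails, so `ψ k s = ψ j s` for all `k`.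
-/
lemma eq_const_or_eq_common {α L : Type*} [Nonempty α] {ψ : α → α → L}
    (h : ∀ j k r r', (ψ j r = ψ j r' ∧ ψ k r = ψ k r') ∨ (ψ j r = ψ k r ∧ ψ j r' = ψ k r')) :
    (∃ τ : α → L, ∀ j r, ψ j r = τ j) ∨ ∃ τ : α → L, ∀ j r, ψ j r = τ r := by
  by_cases hc : ∀ j r r', ψ j r = ψ j r'
  · exact Or.inl ⟨fun j => ψ j (Classical.arbitrary α), fun j r => hc j r _⟩
  · push Not at hc
    obtain ⟨j, r, r', hne⟩ := hc
    refine Or.inr ⟨ψ j, fun k s => ?_⟩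
    by_cases hs : ψ j s = ψ j r
    · have hs' : ψ j s ≠ ψ j r' := fun h' => hne (hs.symm.trans h')
      rcases h j k s r' with h1 | h1
      · exact (hs' h1.1).elim
      · exact h1.1.symm
    · rcases h j k s r with h1 | h1
      · exact (hs h1.1).elim
      · exact h1.1.symm

section Rounding
variable {ι α L : Type*} [Fintype ι] [DecidableEq ι] [Nonempty ι] [Fintype α] [DecidableEq α]
  [Fintype L] [DecidableEq L]

/-- `ψ r` is the label whose unit vector is nearest to `v r`. Each rank has probability `1/m`,
whence the pointwise bound. Where `G` differs from `ψ`, two unit vectors at squared distance `2`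
force an error of at least `1/2`, whence the factor `2`. -/
lemma exists_nearest_label [Nonempty α] (i : ι) (j : α) (G : (ι → Equiv.Perm α) → L)
    (v : α → EuclideanSpace ℝ L) {β : ℝ}
    (hβ : 𝔼 x : ι → Equiv.Perm α, ‖oneHot (G x) - v ((x i)⁻¹ j)‖ ^ 2 ≤ β) :
    ∃ ψ : α → L, (∀ r, ‖oneHot (ψ r) - v r‖ ^ 2 ≤ (Fintype.card α : ℝ) * β) ∧
      𝔼 x : ι → Equiv.Perm α, (if G x ≠ ψ ((x i)⁻¹ j) then (1 : ℝ) else 0) ≤ 2 * β := by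
  have : Nonempty L := ⟨G 1⟩
  choose ψ hψ using fun r => Finite.exists_min fun A : L => ‖oneHot A - v r‖
  refine ⟨ψ, fun r => ?_, ?_⟩
  · have h1 : 𝔼 r, ‖oneHot (ψ r) - v r‖ ^ 2 ≤ β := by
      rw [← expect_coord_inv_apply i j fun r => ‖oneHot (ψ r) - v r‖ ^ 2]
      refine le_trans (Finset.expect_le_expect fun x _ => ?_) hβ
      gcongr
      exact hψ _ _
    rw [Fintype.expect_eq_sum_div_card,
      div_le_iff₀ (Nat.cast_pos.2 Fintype.card_pos), mul_comm] at h1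
    exact (Finset.single_le_sum (f := fun r => ‖oneHot (ψ r) - v r‖ ^ 2)
      (fun _ _ => by positivity) (Finset.mem_univ r)).trans h1
  · calc _ ≤ 𝔼 x : ι → Equiv.Perm α, 2 * ‖oneHot (G x) - v ((x i)⁻¹ j)‖ ^ 2 := by
          refine Finset.expect_le_expect fun x _ => ?_
          have h1 := norm_oneHot_sub_sq (G x) (ψ ((x i)⁻¹ j))
          have h2 := hψ ((x i)⁻¹ j) (G x)
          have h3 := norm_sub_le_norm_sub_add_norm_sub (oneHot (G x)) (v ((x i)⁻¹ j))
            (oneHot (ψ ((x i)⁻¹ j)))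
          rw [norm_sub_rev (v _) (oneHot _)] at h3
          nlinarith [norm_nonneg (oneHot (G x) - v ((x i)⁻¹ j)),
            norm_nonneg (oneHot (G x) - oneHot (ψ ((x i)⁻¹ j)))]
      _ ≤ 2 * β := by rw [← Finset.mul_expect]; linarith

/-- Labels of the alternatives that depend on the whole profile, have a constant histogram, and
have little influence given the ranks of the respective alternative, are close to an exact rule:
constants, or a common function of the rank in one voter's vote. -/
theorem exists_rank_rule (hm : 3 ≤ Fintype.card α) (F : α → (ι → Equiv.Perm α) → L)
    (κ : EuclideanSpace ℝ L) (hκ : ∀ x, ∑ j, oneHot (F j x) = κ) {δ : ℝ}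
    (hδ : ∑ j, ∑ i, influence (F j) j i ≤ δ)
    (hsmall : 147648 * (Fintype.card α : ℝ) ^ 3 * δ < 1) :
    ∃ (i : ι) (ψ : α → α → L),
      (∑ j, 𝔼 x : ι → Equiv.Perm α, (if F j x ≠ ψ j ((x i)⁻¹ j) then (1 : ℝ) else 0) ≤
        18457 * (Fintype.card α : ℝ) ^ 3 * δ) ∧
      ((∃ τ : α → L, ∀ j r, ψ j r = τ j) ∨ ∃ τ : α → L, ∀ j r, ψ j r = τ r) := by
  have hne : Nonempty α := Fintype.card_pos_iff.1 (by omega)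
  set m : ℝ := (Fintype.card α : ℝ) with hmdef
  have hm1 : (1 : ℝ) ≤ m := by rw [hmdef]; exact_mod_cast (by omega : 1 ≤ Fintype.card α)
  have hδ0 : 0 ≤ δ := le_trans (Finset.sum_nonneg fun _ _ => Finset.sum_nonneg fun _ _ =>
    Finset.expect_nonneg fun _ _ => Finset.expect_nonneg fun _ _ => by split_ifs <;> norm_num) hδ
  choose G hG using fun j => exists_near_function_of_ranks (F j) j
  have hGsum : ∑ j, 𝔼 x : ι → Equiv.Perm α,
      (if F j x ≠ G j (ranks x j) then (1 : ℝ) else 0) ≤ δ :=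
    (Finset.sum_le_sum fun j _ => hG j).trans hδ
  -- Cauchy–Schwarz over the alternatives costs `m`; a wrong label costs squared distance `2`.
  have hGκ : 𝔼 x : ι → Equiv.Perm α, ‖∑ j, oneHot (G j (ranks x j)) - κ‖ ^ 2 ≤ 2 * m * δ := by
    calc _ ≤ 𝔼 x : ι → Equiv.Perm α, m * ∑ j, 2 *
            (if F j x ≠ G j (ranks x j) then (1 : ℝ) else 0) := by
          refine Finset.expect_le_expect fun x _ => ?_
          rw [← hκ x, ← Finset.sum_sub_distrib]
          refine (norm_sum_sq_le _).trans ?_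
          gcongr with j
          rw [← norm_oneHot_sub_sq, norm_sub_rev]
      _ = 2 * m * ∑ j, 𝔼 x : ι → Equiv.Perm α,
            (if F j x ≠ G j (ranks x j) then (1 : ℝ) else 0) := by
          rw [← Finset.mul_expect, Finset.expect_sum_comm]
          simp_rw [← Finset.mul_expect, ← Finset.mul_sum]
          ring
      _ ≤ _ := by gcongr
  obtain ⟨i, c, h, hch⟩ := exists_common_voter hm G κ hGκ
  choose ψ hψ1 hψ2 using fun j =>
    exists_nearest_label i j (fun x => G j (ranks x j)) (fun r => c j + h r) (hch j)
  refine ⟨i, ψ, ?_, eq_const_or_eq_common fun j k r r' => oneHot_rect ?_⟩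
  · calc _ ≤ ∑ j, (𝔼 x : ι → Equiv.Perm α, (if F j x ≠ G j (ranks x j) then (1 : ℝ) else 0) +
            2 * (4614 * m * (2 * m * δ))) := by
          refine Finset.sum_le_sum fun j _ => ?_
          refine le_trans ?_ (add_le_add_right (hψ2 j) _)
          rw [← Finset.expect_add_distrib]
          exact Finset.expect_le_expect fun x _ => ite_ne_triangle _ _ _
      _ ≤ δ + m * (2 * (4614 * m * (2 * m * δ))) := by
          rw [Finset.sum_add_distrib, Finset.sum_const, Finset.card_univ, nsmul_eq_mul]
          gcongr
      _ ≤ _ := by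
          have : 1 ≤ m ^ 3 := one_le_pow₀ hm1
          nlinarith [mul_nonneg (sub_nonneg.2 this) hδ0]
  · have hlt : ∀ j r, ‖oneHot (ψ j r) - (c j + h r)‖ < 1 / 4 := by
      intro j r
      have := hψ1 j r
      rw [← hmdef] at this
      refine lt_of_pow_lt_pow_left₀ 2 (by norm_num) (this.trans_lt ?_)
      nlinarith
    have hsplit : oneHot (ψ j r) - oneHot (ψ j r') - oneHot (ψ k r) + oneHot (ψ k r') =
        (oneHot (ψ j r) - (c j + h r)) - (oneHot (ψ j r') - (c j + h r')) -
        (oneHot (ψ k r) - (c k + h r)) + (oneHot (ψ k r') - (c k + h r')) := by abel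
    rw [hsplit]
    have h1 := norm_add_le ((oneHot (ψ j r) - (c j + h r)) - (oneHot (ψ j r') - (c j + h r')) -
      (oneHot (ψ k r) - (c k + h r))) (oneHot (ψ k r') - (c k + h r'))
    have h2 := norm_sub_le ((oneHot (ψ j r) - (c j + h r)) - (oneHot (ψ j r') - (c j + h r')))
      (oneHot (ψ k r) - (c k + h r))
    have h3 := norm_sub_le (oneHot (ψ j r) - (c j + h r)) (oneHot (ψ j r') - (c j + h r'))
    linarith [hlt j r, hlt j r', hlt k r, hlt k r']

end Rounding

/-! ### Partial rankings as labellings of the alternatives -/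

section Labels
variable {m n : ℕ} {H : Subgroup (Ranking m)} {P : Finpartition (Finset.univ : Finset (Fin m))}

/-- The part of the ranks in which the coset `K` places the alternative `j`. -/
noncomputable def label (P : Finpartition (Finset.univ : Finset (Fin m))) (K : PartialRanking H)
    (j : Fin m) : Finset (Fin m) := P.part (K.out⁻¹ j)

lemma part_inv_apply (hP : ∀ σ : Ranking m, σ ∈ H ↔ ∀ A ∈ P.parts, A.image σ = A) {σ : Ranking m}
    (hσ : σ ∈ H) (r : Fin m) : P.part (σ⁻¹ r) = P.part r := by
  have h := (hP _).1 (H.inv_mem hσ) (P.part r) (P.part_mem.2 (Finset.mem_univ r))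
  refine P.part_eq_of_mem (P.part_mem.2 (Finset.mem_univ r)) ?_
  rw [← h]
  exact Finset.mem_image_of_mem _ (P.mem_part_self.2 (Finset.mem_univ r))

lemma label_mk (hP : ∀ σ : Ranking m, σ ∈ H ↔ ∀ A ∈ P.parts, A.image σ = A) (w : Ranking m)
    (j : Fin m) : label P (QuotientGroup.mk w : PartialRanking H) j = P.part (w⁻¹ j) := by
  obtain ⟨h, hh⟩ := QuotientGroup.mk_out_eq_mul H w
  rw [label, hh, mul_inv_rev, Equiv.Perm.mul_apply, part_inv_apply hP h.2]

/-- Equal labels make `w⁻¹ * w'` map each part into itself, hence onto itself by finiteness. -/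
lemma eq_of_label_eq (hP : ∀ σ : Ranking m, σ ∈ H ↔ ∀ A ∈ P.parts, A.image σ = A)
    {K K' : PartialRanking H} (h : ∀ j, label P K j = label P K' j) : K = K' := by
  obtain ⟨w, rfl⟩ := QuotientGroup.mk_surjective K
  obtain ⟨w', rfl⟩ := QuotientGroup.mk_surjective K'
  simp_rw [label_mk hP] at h
  refine QuotientGroup.eq.2 ((hP _).2 fun A hA => ?_)
  refine Finset.eq_of_subset_of_card_le (Finset.image_subset_iff.2 fun r hr => ?_)
    (Finset.card_image_of_injective _ (Equiv.injective _)).ge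
  have h1 := h (w' r)
  rw [show w'⁻¹ (w' r) = r from w'.symm_apply_apply r, P.part_eq_of_mem hA hr] at h1
  exact (P.part_eq_iff_mem hA).1 h1

/-- The fixed part sizes are the constraint tying the alternatives together; all rigidity comes from
it. -/
lemma sum_oneHot_label (K : PartialRanking H) :
    ∑ j, oneHot (label P K j) = ∑ r, oneHot (P.part r) :=
  Equiv.sum_comp K.out⁻¹ fun r => oneHot (P.part r)

lemma mem_members {K : PartialRanking H} {y : Ranking m} :
    y ∈ members K ↔ (QuotientGroup.mk y : PartialRanking H) = K := by
  simp [members]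

lemma card_members (K : PartialRanking H) : (members K).card = Nat.card H := by
  classical
  obtain ⟨w, rfl⟩ := QuotientGroup.mk_surjective K
  rw [Nat.card_eq_fintype_card, ← Finset.card_univ]
  symm
  refine Finset.card_bij (fun (h : H) _ => w * h) ?_ ?_ ?_
  · intro h _
    simp [mem_members]
  · intro h _ h' _ heq
    exact Subtype.ext (mul_left_cancel heq)
  · intro y hy
    exact ⟨⟨w⁻¹ * y, QuotientGroup.eq.1 (mem_members.1 hy).symm⟩, Finset.mem_univ _, by simp⟩

lemma part_eq_label_of_count_ne_zero
    (hP : ∀ σ : Ranking m, σ ∈ H ↔ ∀ A ∈ P.parts, A.image σ = A)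
    {K : PartialRanking H} {j r : Fin m} (h : (jProfile K j).count r ≠ 0) :
    P.part r = label P K j := by
  rw [Multiset.count_ne_zero, jProfile, Multiset.mem_map] at h
  obtain ⟨y, hy, rfl⟩ := h
  rw [← mem_members.1 hy, label_mk hP]

lemma sum_count_jProfile_div (K : PartialRanking H) (j : Fin m) :
    ∑ r, ((jProfile K j).count r : ℝ) / (Nat.card H : ℝ) = 1 := by
  have h : ∑ r, (jProfile K j).count r = Nat.card H := by
    rw [Multiset.sum_count_eq_card fun _ _ => Finset.mem_univ _, jProfile, Multiset.card_map,
      ← card_members K]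
    rfl
  rw [← Finset.sum_div, ← Nat.cast_sum, h, div_self]
  exact Nat.cast_ne_zero.2 Nat.card_pos.ne'

lemma inv_le_sum_sq {p : Fin m → ℝ} (h : ∑ r, p r = 1) : (m : ℝ)⁻¹ ≤ ∑ r, p r ^ 2 := by
  have h1 := sq_sum_le_card_mul_sum_sq (s := Finset.univ) (f := p)
  rw [h, one_pow, Finset.card_univ, Fintype.card_fin] at h1
  have hm : (0 : ℝ) < m := by
    refine Nat.cast_pos.2 (Nat.pos_of_ne_zero ?_)
    rintro rfl
    simp at h
  rwa [inv_le_iff_one_le_mul₀' hm]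

/-- Normalised profiles are probability vectors on `m` ranks, so their squared norms are at least
`1/m`. Different labels give disjoint supports, and the squared norms add. -/
lemma le_jDistSq (hP : ∀ σ : Ranking m, σ ∈ H ↔ ∀ A ∈ P.parts, A.image σ = A)
    (K K' : PartialRanking H) (j : Fin m) :
    2 * (m : ℝ)⁻¹ * (if label P K j ≠ label P K' j then (1 : ℝ) else 0) ≤ jDistSq K K' j := by
  split_ifs with hne
  · have h : jDistSq K K' j = ∑ r, (((jProfile K j).count r : ℝ) / (Nat.card H : ℝ)) ^ 2 +
        ∑ r, (((jProfile K' j).count r : ℝ) / (Nat.card H : ℝ)) ^ 2 := by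
      rw [jDistSq, ← Finset.sum_add_distrib]
      refine Finset.sum_congr rfl fun r _ => ?_
      by_cases h0 : (jProfile K j).count r = 0
      · simp [h0, neg_div]
      · have h1 : (jProfile K' j).count r = 0 := by
          by_contra h1
          exact hne ((part_eq_label_of_count_ne_zero hP h0).symm.trans
            (part_eq_label_of_count_ne_zero hP h1))
        simp [h1]
    rw [h]
    have h1 := inv_le_sum_sq (sum_count_jProfile_div K j)
    have h2 := inv_le_sum_sq (sum_count_jProfile_div K' j)
    linarith
  · rw [mul_zero]
    exact Finset.sum_nonneg fun _ _ => by positivity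

/-- One factor `2/m` is the distance caused by a changed label (`le_jDistSq`); another `1/m` is the
probability that a new vote keeps the rank of `j`. -/
lemma sum_influence_le_IR (hP : ∀ σ : Ranking m, σ ∈ H ↔ ∀ A ∈ P.parts, A.image σ = A)
    (hm : 0 < m) (f : Aggregator n H) :
    ∑ j, ∑ i, influence (fun x => label P (f x) j) j i ≤ (m : ℝ) ^ 2 / 2 * IR f := by
  have hm' : (0 : ℝ) < m := Nat.cast_pos.2 hm
  have h : 2 * (m : ℝ)⁻¹ * (m : ℝ)⁻¹ *
      ∑ j, ∑ i, influence (fun x => label P (f x) j) j i ≤ IR f := by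
    rw [Finset.sum_comm, IR]
    simp_rw [Finset.mul_sum]
    refine Finset.sum_le_sum fun i _ => Finset.sum_le_sum fun j _ => ?_
    have hx : ∀ x : Profile n m, 2 * (m : ℝ)⁻¹ * (m : ℝ)⁻¹ * 𝔼 σ : Stab j,
        (if label P (f x) j ≠ label P (f (Function.update x i (σ • x i))) j then (1 : ℝ) else 0) =
        𝔼 z : Ranking m, if (x i)⁻¹ j = z⁻¹ j then 2 * (m : ℝ)⁻¹ *
          (if label P (f x) j ≠ label P (f (Function.update x i z)) j then (1 : ℝ) else 0)
          else 0 := by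
      intro x
      rw [expect_ite_inv_apply_eq j (x i) fun z => 2 * (m : ℝ)⁻¹ *
          (if label P (f x) j ≠ label P (f (Function.update x i z)) j then (1 : ℝ) else 0),
        ← Finset.mul_expect, Fintype.card_fin]
      ring
    rw [influence, Finset.expect_comm, Finset.mul_expect]
    refine Finset.expect_le_expect fun x _ => ?_
    rw [hx]
    refine Finset.expect_le_expect fun z _ => ?_
    by_cases hz : (x i)⁻¹ j = z⁻¹ j
    · rw [if_pos hz, if_pos hz]
      exact le_jDistSq hP _ _ _
    · rw [if_neg hz, if_neg hz]
  calc _ = (m : ℝ) ^ 2 / 2 * (2 * (m : ℝ)⁻¹ * (m : ℝ)⁻¹ *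
        ∑ j, ∑ i, influence (fun x => label P (f x) j) j i) := by field_simp
    _ ≤ _ := by gcongr

lemma dist_le_one (f g : Aggregator n H) : dist f g ≤ 1 := by
  classical
  exact Finset.expect_le Finset.univ_nonempty fun x _ => by split_ifs <;> norm_num

lemma dist_le_sum_label (hP : ∀ σ : Ranking m, σ ∈ H ↔ ∀ A ∈ P.parts, A.image σ = A)
    (f g : Aggregator n H) :
    dist f g ≤ ∑ j, 𝔼 x : Profile n m,
      if label P (f x) j ≠ label P (g x) j then (1 : ℝ) else 0 := by
  rw [← Finset.expect_sum_comm, dist]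
  refine Finset.expect_le_expect fun x _ => ?_
  have hnn : ∀ j ∈ Finset.univ, (0 : ℝ) ≤ if label P (f x) j ≠ label P (g x) j then 1 else 0 :=
    fun j _ => by split_ifs <;> norm_num
  split_ifs with h
  · obtain ⟨j, hj⟩ : ∃ j, label P (f x) j ≠ label P (g x) j := by
      by_contra! hall
      exact h (eq_of_label_eq hP hall)
    refine le_trans ?_ (Finset.single_le_sum hnn (Finset.mem_univ j))
    rw [if_pos hj]
  · exact Finset.sum_nonneg hnn

/-- An aggregator that nearly follows an exact rule, given by constants or by a common function
of the rank in one voter's vote, is close to a constant or to a dictator. -/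
lemma exists_constant_or_dictatorial
    (hP : ∀ σ : Ranking m, σ ∈ H ↔ ∀ A ∈ P.parts, A.image σ = A) (f : Aggregator n H) (i : Fin n)
    (ψ : Fin m → Fin m → Finset (Fin m)) {η : ℝ} (hη1 : η < 1)
    (hη : ∑ j, 𝔼 x : Profile n m,
      (if label P (f x) j ≠ ψ j ((x i)⁻¹ j) then (1 : ℝ) else 0) ≤ η)
    (hψ : (∃ τ : Fin m → Finset (Fin m), ∀ j r, ψ j r = τ j) ∨
      ∃ τ : Fin m → Finset (Fin m), ∀ j r, ψ j r = τ r) :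
    ∃ g : Aggregator n H, (IsConstant g ∨ IsDictatorial g) ∧ dist f g ≤ η := by
  -- As `η < 1`, some profile breaks the rule for no alternative. Its outcome certifies that the
  -- rule is realised by an actual coset.
  obtain ⟨x₀, hx₀⟩ : ∃ x₀ : Profile n m, ∀ j, label P (f x₀) j = ψ j ((x₀ i)⁻¹ j) := by
    rw [← Finset.expect_sum_comm] at hη
    obtain ⟨x₀, -, hx₀⟩ := Finset.exists_lt_of_expect_lt Finset.univ_nonempty (hη.trans_lt hη1)
    refine ⟨x₀, fun j => ?_⟩
    by_contra hne
    have := Finset.single_le_sum (f := fun j => if label P (f x₀) j ≠ ψ j ((x₀ i)⁻¹ j) then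
      (1 : ℝ) else 0) (fun j _ => by split_ifs <;> norm_num) (Finset.mem_univ j)
    rw [if_pos hne] at this
    linarith
  suffices h : ∃ g : Aggregator n H, (IsConstant g ∨ IsDictatorial g) ∧
      ∀ x j, label P (g x) j = ψ j ((x i)⁻¹ j) by
    obtain ⟨g, hg, hlabel⟩ := h
    refine ⟨g, hg, (dist_le_sum_label hP f g).trans ?_⟩
    simpa only [hlabel] using hη
  rcases hψ with ⟨τ, hτ⟩ | ⟨τ, hτ⟩
  · refine ⟨fun _ => f x₀, Or.inl ⟨f x₀, fun _ => rfl⟩, fun x j => ?_⟩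
    rw [hx₀, hτ, hτ]
  · obtain ⟨w, hw⟩ := QuotientGroup.mk_surjective (f x₀)
    refine ⟨fun x => QuotientGroup.mk (x i * ((x₀ i)⁻¹ * w)), Or.inr ⟨i, _, fun _ => rfl⟩,
      fun x j => ?_⟩
    -- The alternative that `x₀ i` ranks where `x i` ranks `j`.
    have h := hx₀ (x₀ i ((x i)⁻¹ j))
    rw [← hw, label_mk hP, hτ,
      show (x₀ i)⁻¹ (x₀ i ((x i)⁻¹ j)) = (x i)⁻¹ j from (x₀ i).symm_apply_apply _] at h
    rw [label_mk hP, hτ, ← h]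
    simp [mul_inv_rev]

end Labels
end SocialIR

/-! ### Assembly and choice of constants -/

theorem theorem3p4 :
    ∃ (C : ℝ) (k : ℕ), 0 < C ∧
      ∀ (m : ℕ), 3 ≤ m →
      ∀ (H : Subgroup (SocialIR.Ranking m)), SocialIR.IsFixing H →
      ∀ (n : ℕ) (f : SocialIR.Aggregator n H) (ε : ℝ), SocialIR.IsEpsIR f ε →
        ∃ g : SocialIR.Aggregator n H,
          (SocialIR.IsConstant g ∨ SocialIR.IsDictatorial g) ∧
          SocialIR.dist f g ≤ C * (m : ℝ) ^ k * ε := by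
  -- With `δ = m² ε / 2` the smallness condition of `exists_rank_rule` reads `73824 m⁵ ε < 1`, and
  -- its bound is at most `9229 m⁵ ε`; `80000` covers both. If `80000 m⁵ ε ≥ 1`, any constant will
  -- do.
  refine ⟨80000, 5, by norm_num, fun m hm H hH n f ε hε => ?_⟩
  obtain ⟨P, -, hP⟩ := hH
  by_cases hbig : 1 ≤ 80000 * (m : ℝ) ^ 5 * ε
  · exact ⟨fun _ => f 1, Or.inl ⟨f 1, fun _ => rfl⟩, (SocialIR.dist_le_one _ _).trans hbig⟩
  push Not at hbig
  have hm0 : (0 : ℝ) < m := by positivity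
  -- Without voters there is a single profile and `f` itself is constant; `IR f = 0` still gives `0
  -- ≤ ε`.
  rcases Nat.eq_zero_or_pos n with rfl | hn
  · refine ⟨f, Or.inl ⟨f 1, fun x => congrArg f (Subsingleton.elim _ _)⟩, ?_⟩
    have h0 : 0 ≤ ε := by
      have : SocialIR.IR f = 0 := by simp [SocialIR.IR]
      exact this.symm.le.trans hε
    have h1 : SocialIR.dist f f = 0 := by simp [SocialIR.dist]
    rw [h1]
    positivity
  have : Nonempty (Fin n) := ⟨⟨0, hn⟩⟩
  have hδ : ∑ j, ∑ i, SocialIR.influence (fun x => SocialIR.label P (f x) j) j i ≤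
      (m : ℝ) ^ 2 / 2 * ε :=
    (SocialIR.sum_influence_le_IR hP (by omega) f).trans
      (mul_le_mul_of_nonneg_left hε (by positivity))
  have hδ0 : 0 ≤ (m : ℝ) ^ 5 * ε := by
    have h1 : 0 ≤ (m : ℝ) ^ 2 / 2 * ε := le_trans (Finset.sum_nonneg fun _ _ =>
      Finset.sum_nonneg fun _ _ => Finset.expect_nonneg fun _ _ => Finset.expect_nonneg
        fun _ _ => by split_ifs <;> norm_num) hδ
    have h2 : 0 ≤ ε := nonneg_of_mul_nonneg_right h1 (by positivity)
    positivity
  obtain ⟨i, ψ, hψ, hrule⟩ := SocialIR.exists_rank_rule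
    (F := fun j x => SocialIR.label P (f x) j) (by simpa using hm) _
    (fun x => SocialIR.sum_oneHot_label (f x)) hδ
    (by rw [Fintype.card_fin]; linarith)
  rw [Fintype.card_fin] at hψ
  obtain ⟨g, hg, hdist⟩ := SocialIR.exists_constant_or_dictatorial hP f i ψ (by linarith) hψ hrule
  exact ⟨g, hg, hdist.trans (by linarith)⟩
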